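/- Let $l,n\ge 0$ be integers. On the superspace $\mathbb{R}^{2l+1|n}$, with superfunctions $C^\infty(\mathbb{R}^{2l+1})\otimes\Lambda\mathbb{R}^n$ and coordinates $z,x_1,\dots,x_l,y_1,\dots,y_l$ (even), $\theta_1,\dots,\theta_n$ (odd), let $\mathrm{Vect}(\mathbb{R}^{2l+1|n})$ be the Lie superalgebra of superderivations, and let $$\alpha=dz+\sum_i(x_i\,dy_i-y_i\,dx_i)+\sum_j\theta_j\,d\theta_j=dz+\sum_{r,s}\omega_{rs}q^r\,dq^s$$ be the standard contact form, where $q=(x,y,\theta)$. Let $\mathrm{Tan}=\ker\alpha$ and let $\mathcal K(2l+1|n)$ be the space of vector fields $X$ with $[X,T]\in\mathrm{Tan}$ for all $T\in\mathrm{Tan}$. With $(\omega^{rs})$ the inverse of the matrix $(\omega_{rs})$ and $T_r=\partial_{q^r}-\sum_k\omega_{kr}q^k\partial_z$, put $$X_f=f\partial_z-\tfrac12\sum_{r,s}(-1)^{\tilde f\tilde T_r}\omega^{rs}T_r(f)T_s$$ for homogeneous $f$, extended linearly in $f$, and let $\mathfrak g$ be the space of the fields $X_f$, where $f$ is a polynomial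 superfunction of degree at most two in $z,x_i,y_i,\theta_j$. Let $\mathfrak{spo}(2l+2|n)\subset\mathfrak{gl}(2l+2|n)$ be the Lie superalgebra spanned by the homogeneous matrices $A$ with $\omega(AU,V)+(-1)^{\tilde A\tilde U}\omega(U,AV)=0$ for all homogeneous $U$ and all $V$ in $\mathbb R^{2l+2|n}$, where $\omega(U,V)=V^tGU$, $G=\mathrm{diag}(J,\mathrm{id}_n)$ and $J=\begin{pmatrix}0&-\mathrm{id}_{l+1}\\ \mathrm{id}_{l+1}&0\end{pmatrix}$. Let $\mathfrak{pgl}(2l+2|n)=\mathfrak{gl}(2l+2|n)/\mathbb R\,\mathrm{Id}$. The projective embedding $P:\mathfrak{pgl}(2l+2|n)\to\mathrm{Vect}(\mathbb R^{2l+1|n})$ is $$\left[\begin{pmatrix}0&\xi\\ v&B\end{pmatrix}\right]\mapsto-\sum_i v^i\partial_{t^i}-\sum_{i,j}(-1)^{\tilde j(\tilde i+\tilde j)}B^i_jt^j\partial_{t^i}+\sum_{i,j}(-1)^{\tilde j}\xi_jt^jt^i\partial_{t^i},$$ where $(t^1,\dots,t^{2l+1+n})=(x_1,\dots,x_l,z,y_1,\dots,y_l,\theta_1,\dots,\theta_n)$.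 **Theorem.** $P$ is an injective morphism of Lie superalgebras into $\mathrm{Vect}(\mathbb R^{2l+1|n})$, and the map $\iota:\mathfrak{spo}(2l+2|n)\to\mathfrak{pgl}(2l+2|n)$, $A\mapsto[A]$, is injective. The space $\mathfrak g$ is a Lie sub-superalgebra consisting of contact vector fields, and $P\circ\iota$ is an isomorphism of Lie superalgebras from $\mathfrak{spo}(2l+2|n)$ onto $\mathfrak g$. Consequently the image of $\mathfrak{spo}(2l+2|n)$ lies in the intersection of $P(\mathfrak{pgl}(2l+2|n))$ and $\mathcal K(2l+1|n)$, i.e. it consists of contact projective vector fields. -/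

import Mathlib

open scoped TensorProduct Manifold ContDiff

noncomputable section

namespace SuperContact

/-! ### Real superalgebras and Lie superalgebras -/

/-- An associative real superalgebra.  The `ℤ/2`-grading is encoded by the involutive automorphism
`par` acting on homogeneous elements `a` as `(-1)^|a|`. -/
class SuperAlgebra (A : Type*) [Ring A] [Algebra ℝ A] where
  par : A →ₐ[ℝ] A
  par_par : ∀ a, par (par a) = a

/-- A real Lie superalgebra; `par` is the involution acting on homogeneous elements as `(-1)^|x|`.
The (anti)symmetry and Jacobi laws are stated for homogeneous elements. -/
class LieSuperalgebra (L : Type*) [AddCommGroup L] [Module ℝ L] where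
  par : L →ₗ[ℝ] L
  par_par : ∀ x, par (par x) = x
  bracket : L →ₗ[ℝ] L →ₗ[ℝ] L
  par_bracket : ∀ x y, par (bracket x y) = bracket (par x) (par y)
  skew : ∀ (p q : ℕ) (x y : L), par x = (-1 : ℝ) ^ p • x → par y = (-1 : ℝ) ^ q • y →
    bracket x y = -((-1 : ℝ) ^ (p * q) • bracket y x)
  jacobi : ∀ (p q r : ℕ) (x y z : L), par x = (-1 : ℝ) ^ p • x → par y = (-1 : ℝ) ^ q • y →
    par z = (-1 : ℝ) ^ r • z →
    bracket x (bracket y z) =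
      bracket (bracket x y) z + (-1 : ℝ) ^ (p * q) • bracket y (bracket x z)

section Assoc

variable {A : Type*} [Ring A] [Algebra ℝ A] [SuperAlgebra A]

/-- The supercommutator `ab - (-1)^(|a||b|) ba`, extended bilinearly: with `b = b₀ + b₁` the
decomposition into even and odd parts, it is `ab - b₀ a - b₁ (par a)`. -/
def superComm : A →ₗ[ℝ] A →ₗ[ℝ] A :=
  LinearMap.mk₂ ℝ
    (fun a b => a * b - ((1 / 2 : ℝ) • (b + SuperAlgebra.par b)) * a
      - ((1 / 2 : ℝ) • (b - SuperAlgebra.par b)) * SuperAlgebra.par a)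
    (by intro a a' b; simp only [map_add, mul_add, add_mul]; abel)
    (by intro c a b; simp only [map_smul, mul_smul_comm, smul_mul_assoc, smul_sub])
    (by intro a b b'
        simp only [map_add, mul_add, add_mul, smul_add, smul_sub, sub_mul]; abel)
    (by intro c a b
        simp only [map_smul, mul_smul_comm, smul_mul_assoc, smul_sub, smul_add, add_mul, sub_mul,
          smul_comm c (1 / 2 : ℝ)])

theorem superComm_apply (a b : A) : superComm a b =
    a * b - ((1 / 2 : ℝ) • (b + SuperAlgebra.par b)) * a
      - ((1 / 2 : ℝ) • (b - SuperAlgebra.par b)) * SuperAlgebra.par a := rfl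

/-- On homogeneous elements `superComm` is the usual supercommutator. -/
theorem superComm_homog (p q : ℕ) (a b : A)
    (ha : SuperAlgebra.par a = (-1 : ℝ) ^ p • a) (hb : SuperAlgebra.par b = (-1 : ℝ) ^ q • b) :
    superComm a b = a * b - (-1 : ℝ) ^ (p * q) • (b * a) := by
  rw [superComm_apply, ha, hb]
  have h2 : (1 / 2 : ℝ) • (b + b) = b := by
    rw [← two_smul ℝ b, smul_smul]; norm_num
  rcases Nat.even_or_odd q with hq | hq
  · rw [hq.neg_one_pow, (hq.mul_left p).neg_one_pow]
    simp only [one_smul, h2, sub_self, smul_zero, zero_mul, sub_zero]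
  · rw [hq.neg_one_pow, mul_comm p q, pow_mul, hq.neg_one_pow]
    simp only [neg_smul, one_smul, add_neg_cancel, smul_zero, zero_mul, sub_zero, sub_neg_eq_add,
      h2, mul_smul_comm]

theorem par_superComm (a b : A) : SuperAlgebra.par (superComm a b) =
    superComm (SuperAlgebra.par a) (SuperAlgebra.par b) := by
  simp only [superComm_apply, map_sub, map_mul, map_smul, map_add]

instance : LieSuperalgebra A where
  par := SuperAlgebra.par.toLinearMap
  par_par := SuperAlgebra.par_par
  bracket := superComm
  par_bracket := par_superComm
  skew := by
    intro p q x y hx hy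
    rw [superComm_homog p q x y hx hy, superComm_homog q p y x hy hx, smul_sub, smul_smul,
      mul_comm q p, ← mul_pow]
    simp
  jacobi := by
    intro p q r x y z hx hy hz
    have hom : ∀ (p q : ℕ) (x y : A), SuperAlgebra.par x = (-1 : ℝ) ^ p • x →
        SuperAlgebra.par y = (-1 : ℝ) ^ q • y →
        SuperAlgebra.par (superComm x y) = (-1 : ℝ) ^ (p + q) • superComm x y := by
      intro p q x y hx hy
      rw [par_superComm, hx, hy, map_smul, map_smul, LinearMap.smul_apply, smul_smul, pow_add,
        mul_comm]
    rw [superComm_homog p (q + r) _ _ hx (hom q r y z hy hz),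
      superComm_homog (p + q) r _ _ (hom p q x y hx hy) hz,
      superComm_homog q (p + r) _ _ hy (hom p r x z hx hz),
      superComm_homog p q x y hx hy, superComm_homog q r y z hy hz,
      superComm_homog p r x z hx hz]
    simp only [mul_add, add_mul, pow_add, mul_comm q p]
    rcases neg_one_pow_eq_or ℝ (p * q) with h1 | h1 <;>
    rcases neg_one_pow_eq_or ℝ (p * r) with h2 | h2 <;>
    rcases neg_one_pow_eq_or ℝ (q * r) with h3 | h3 <;>
    rw [h1, h2, h3] <;> simp <;> noncomm_ring

/-- Linear endomorphisms of a superalgebra form a superalgebra. -/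
instance : SuperAlgebra (Module.End ℝ A) where
  par := AlgHom.ofLinearMap
    (LinearMap.mulLeftRight ℝ
      ((SuperAlgebra.par (A := A)).toLinearMap, (SuperAlgebra.par (A := A)).toLinearMap))
    (by ext a; simp [SuperAlgebra.par_par])
    (by intro D D'; ext a; simp [SuperAlgebra.par_par])
  par_par := by intro D; ext a; simp [SuperAlgebra.par_par]

theorem par_end_apply (D : Module.End ℝ A) (a : A) :
    SuperAlgebra.par D a = SuperAlgebra.par (D (SuperAlgebra.par a)) := rfl

variable (A) in
/-- Superderivations of `A` of parity `p`: endomorphisms `D` of parity `p` with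
`D(fg) = D(f) g + (-1)^(p |f|) f D(g)`. -/
def superDer (p : ℕ) : Submodule ℝ (Module.End ℝ A) where
  carrier := {D | SuperAlgebra.par D = (-1 : ℝ) ^ p • D ∧
    ∀ f g : A, D (f * g) = D f * g + (SuperAlgebra.par (A := A))^[p] f * D g}
  zero_mem' := by simp
  add_mem' := by
    rintro D D' ⟨h1, h2⟩ ⟨h1', h2'⟩
    refine ⟨by rw [map_add, h1, h1', smul_add], fun f g => ?_⟩
    simp only [LinearMap.add_apply, h2, h2', add_mul, mul_add]; abel
  smul_mem' := by
    rintro c D ⟨h1, h2⟩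
    refine ⟨by rw [map_smul, h1, smul_comm], fun f g => ?_⟩
    simp only [LinearMap.smul_apply, h2, smul_add, smul_mul_assoc, mul_smul_comm]

/-- The part of parity `p` of an element. -/
def homPart {L : Type*} [AddCommGroup L] [Module ℝ L] [LieSuperalgebra L] (p : ℕ) (x : L) : L :=
  (1 / 2 : ℝ) • (x + (-1 : ℝ) ^ p • LieSuperalgebra.par x)

/-- The line of scalars `ℝ·1`. -/
abbrev scalars (A : Type*) [Ring A] [Algebra ℝ A] : Submodule ℝ A := Submodule.span ℝ {1}

theorem superComm_one_right (a : A) : superComm a 1 = 0 := by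
  rw [superComm_apply, map_one, ← two_smul ℝ (1 : A), smul_smul]; norm_num

theorem superComm_one_left (a : A) : superComm 1 a = 0 := by
  rw [superComm_apply, map_one, mul_one, mul_one, one_mul, sub_sub, ← smul_add,
    add_add_sub_cancel, ← two_smul ℝ a, smul_smul]
  norm_num

/-- The parity on the quotient by scalars. -/
def quotPar : (A ⧸ scalars A) →ₗ[ℝ] (A ⧸ scalars A) :=
  (scalars A).mapQ (scalars A) SuperAlgebra.par.toLinearMap
    (by rw [Submodule.span_le]; rintro _ rfl
        simp)

/-- The bracket on the quotient by scalars, `[[a], [b]] = [[a, b]]`. -/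
def quotBracket : (A ⧸ scalars A) →ₗ[ℝ] (A ⧸ scalars A) →ₗ[ℝ] (A ⧸ scalars A) :=
  (scalars A).liftQ
    { toFun := fun a => (scalars A).liftQ ((scalars A).mkQ ∘ₗ superComm a)
        (by rw [Submodule.span_le]; rintro _ rfl; simp [superComm_one_right])
      map_add' := by intro a b; ext x; simp
      map_smul' := by intro a b; ext x; simp }
    (by rw [Submodule.span_le]; rintro _ rfl
        rw [SetLike.mem_coe, LinearMap.mem_ker]; ext x
        change (scalars A).mkQ (superComm 1 x) = 0
        rw [superComm_one_left, map_zero])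

theorem quotPar_mk (a : A) :
    quotPar ((scalars A).mkQ a) = (scalars A).mkQ (SuperAlgebra.par a) := rfl

theorem quotBracket_mk (a b : A) : quotBracket ((scalars A).mkQ a) ((scalars A).mkQ b) =
    (scalars A).mkQ (superComm a b) := rfl

theorem exists_homog_lift (p : ℕ) (x : A ⧸ scalars A) (hx : quotPar x = (-1 : ℝ) ^ p • x) :
    ∃ a : A, (scalars A).mkQ a = x ∧ SuperAlgebra.par a = (-1 : ℝ) ^ p • a := by
  obtain ⟨a, rfl⟩ := (scalars A).mkQ_surjective x
  have hp : (-1 : ℝ) ^ p * (-1 : ℝ) ^ p = 1 := by rw [← mul_pow]; simp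
  refine ⟨(1 / 2 : ℝ) • (a + (-1 : ℝ) ^ p • SuperAlgebra.par a), ?_, ?_⟩
  · rw [map_smul, map_add, map_smul, ← quotPar_mk, hx, smul_smul, hp, one_smul,
      ← two_smul ℝ, smul_smul]
    norm_num
  · rw [map_smul, map_add, map_smul, SuperAlgebra.par_par, smul_comm _ (1 / 2 : ℝ), smul_add _ a,
      smul_smul _ _ (SuperAlgebra.par a), hp, one_smul, add_comm]

/-- The quotient of an associative superalgebra by its scalars is a Lie superalgebra. -/
instance : LieSuperalgebra (A ⧸ scalars A) where
  par := quotPar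
  par_par := by
    intro x; obtain ⟨a, rfl⟩ := (scalars A).mkQ_surjective x
    rw [quotPar_mk, quotPar_mk, SuperAlgebra.par_par]
  bracket := quotBracket
  par_bracket := by
    intro x y
    obtain ⟨a, rfl⟩ := (scalars A).mkQ_surjective x
    obtain ⟨b, rfl⟩ := (scalars A).mkQ_surjective y
    rw [quotBracket_mk, quotPar_mk, par_superComm, quotPar_mk, quotPar_mk, quotBracket_mk]
  skew := by
    intro p q x y hx hy
    obtain ⟨a, rfl, ha⟩ := exists_homog_lift p x hx
    obtain ⟨b, rfl, hb⟩ := exists_homog_lift q y hy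
    rw [quotBracket_mk, quotBracket_mk, ← map_smul, ← map_neg]
    exact congrArg _ (LieSuperalgebra.skew (L := A) p q a b ha hb)
  jacobi := by
    intro p q r x y z hx hy hz
    obtain ⟨a, rfl, ha⟩ := exists_homog_lift p x hx
    obtain ⟨b, rfl, hb⟩ := exists_homog_lift q y hy
    obtain ⟨c, rfl, hc⟩ := exists_homog_lift r z hz
    simp only [quotBracket_mk]
    rw [← map_smul, ← map_add]
    exact congrArg _ (LieSuperalgebra.jacobi (L := A) p q r a b c ha hb hc)

end Assoc

/-- A morphism of Lie superalgebras: even and compatible with brackets. -/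
structure IsLieSuperHom {L L' : Type*} [AddCommGroup L] [Module ℝ L] [LieSuperalgebra L]
    [AddCommGroup L'] [Module ℝ L'] [LieSuperalgebra L'] (f : L →ₗ[ℝ] L') : Prop where
  map_par : ∀ x, f (LieSuperalgebra.par x) = LieSuperalgebra.par (f x)
  map_bracket : ∀ x y, f (LieSuperalgebra.bracket x y) = LieSuperalgebra.bracket (f x) (f y)

/-- Lie sub-superalgebras: graded subspaces closed under the bracket. -/
structure IsLieSubsuperalgebra {L : Type*} [AddCommGroup L] [Module ℝ L] [LieSuperalgebra L]
    (S : Submodule ℝ L) : Prop where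
  par_mem : ∀ x ∈ S, LieSuperalgebra.par x ∈ S
  bracket_mem : ∀ x ∈ S, ∀ y ∈ S, LieSuperalgebra.bracket x y ∈ S

/-- `e` is an isomorphism of Lie superalgebras between the Lie sub-superalgebras `S` and `S'`:
a linear bijection that is even and compatible with the brackets. -/
structure IsLieSuperIso {L L' : Type*} [AddCommGroup L] [Module ℝ L] [LieSuperalgebra L]
    [AddCommGroup L'] [Module ℝ L'] [LieSuperalgebra L']
    {S : Submodule ℝ L} {S' : Submodule ℝ L'} (e : S ≃ₗ[ℝ] S') : Prop where
  source : IsLieSubsuperalgebra S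
  target : IsLieSubsuperalgebra S'
  map_par : ∀ a : S, (e ⟨LieSuperalgebra.par (a : L), source.par_mem _ a.2⟩ : L') =
    LieSuperalgebra.par (e a : L')
  map_bracket : ∀ a b : S,
    (e ⟨LieSuperalgebra.bracket (a : L) (b : L), source.bracket_mem _ a.2 _ b.2⟩ : L') =
      LieSuperalgebra.bracket (e a : L') (e b : L')

/-! ### Superfunctions on `ℝ^{2l+1|n}` -/

/-- Even coordinates: `none` is `z`, `some (inl i)` is `x_i`, `some (inr i)` is `y_i`. -/
abbrev EvenIdx (l : ℕ) := Option (Fin l ⊕ Fin l)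

/-- All coordinates: `inl` for the even ones, `inr j` is `θ_j`. -/
abbrev Idx (l n : ℕ) := EvenIdx l ⊕ Fin n

/-- The coordinates `q^r`, that is, all coordinates except `z`. -/
abbrev QIdx (l n : ℕ) := (Fin l ⊕ Fin l) ⊕ Fin n

/-- `q^r` as a coordinate. -/
def QIdx.toIdx {l n : ℕ} : QIdx l n → Idx l n := Sum.map some id

/-- The coordinate `z`. -/
def zIdx (l n : ℕ) : Idx l n := Sum.inl none

/-- The parity of an index: `0` in the left (even) summand, `1` in the right (odd) summand. -/
def parity {α β : Type*} : α ⊕ β → ℕ := Sum.elim (fun _ => 0) (fun _ => 1)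

/-- `C^∞(ℝ^{2l+1})`. -/
abbrev Smooth (l : ℕ) := C^∞⟮𝓘(ℝ, EvenIdx l → ℝ), EvenIdx l → ℝ; 𝓘(ℝ, ℝ), ℝ⟯

/-- `C^∞(ℝ^{2l+1|n}) = C^∞(ℝ^{2l+1}) ⊗ Λ ℝ^n`. -/
def SFun (l n : ℕ) : Type := Smooth l ⊗[ℝ] ExteriorAlgebra ℝ (Fin n → ℝ)

instance (l n : ℕ) : Ring (SFun l n) :=
  inferInstanceAs (Ring (Smooth l ⊗[ℝ] ExteriorAlgebra ℝ (Fin n → ℝ)))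

instance (l n : ℕ) : Algebra ℝ (SFun l n) :=
  inferInstanceAs (Algebra ℝ (Smooth l ⊗[ℝ] ExteriorAlgebra ℝ (Fin n → ℝ)))

instance (l n : ℕ) : SuperAlgebra (SFun l n) where
  par := Algebra.TensorProduct.map (AlgHom.id ℝ (Smooth l)) CliffordAlgebra.involute
  par_par := by
    intro a
    refine TensorProduct.induction_on a ?_ ?_ ?_
    · exact (congrArg _ (map_zero _)).trans (map_zero _)
    · intro f w
      change f ⊗ₜ[ℝ] CliffordAlgebra.involute (CliffordAlgebra.involute w) = _
      rw [CliffordAlgebra.involute_involute]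
    · intro a b ha hb
      exact (congrArg _ (map_add _ a b)).trans ((map_add _ _ _).trans (congrArg₂ _ ha hb))

/-- Partial derivative of a smooth function. -/
def smoothDeriv {l : ℕ} (e : EvenIdx l) : Smooth l →ₗ[ℝ] Smooth l where
  toFun f := ⟨fun x => fderiv ℝ f x (Pi.single e 1),
    ((f.contMDiff.contDiff.fderiv_right (m := ∞) le_rfl).clm_apply contDiff_const).contMDiff⟩
  map_add' f g := by
    ext x
    have hf : DifferentiableAt ℝ f x := (f.contMDiff.contDiff.differentiable (by simp)) x
    have hg : DifferentiableAt ℝ g x := (g.contMDiff.contDiff.differentiable (by simp)) x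
    change fderiv ℝ ((f : (EvenIdx l → ℝ) → ℝ) + (g : (EvenIdx l → ℝ) → ℝ)) x _ = fderiv ℝ f x _ + fderiv ℝ g x _
    rw [fderiv_add hf hg]; rfl
  map_smul' c f := by
    ext x
    have hf : DifferentiableAt ℝ f x := (f.contMDiff.contDiff.differentiable (by simp)) x
    change fderiv ℝ (c • (f : (EvenIdx l → ℝ) → ℝ)) x _ = c • fderiv ℝ f x _
    rw [fderiv_const_smul hf]; rfl

/-- The coordinate superfunctions. -/
def coord {l n : ℕ} : Idx l n → SFun l n
  | Sum.inl e => (⟨fun x => x e, (contDiff_apply ℝ ℝ e).contMDiff⟩ : Smooth l) ⊗ₜ[ℝ] 1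
  | Sum.inr j => 1 ⊗ₜ[ℝ] ExteriorAlgebra.ι ℝ (Pi.single j 1)

/-- The coordinate vector fields `∂_{t^i}` as endomorphisms of the superfunctions; `∂_{θ_j}` is the
left derivative, i.e. contraction with the `j`-th coordinate form. -/
def del {l n : ℕ} : Idx l n → Module.End ℝ (SFun l n)
  | Sum.inl e => TensorProduct.map (smoothDeriv e) LinearMap.id
  | Sum.inr j => TensorProduct.map LinearMap.id (CliffordAlgebra.contractLeft (LinearMap.proj j))

/-- Multiplication on the left by a superfunction; `lmul f * D` is the vector field `f D`. -/
abbrev lmul {l n : ℕ} (f : SFun l n) : Module.End ℝ (SFun l n) := LinearMap.mulLeft ℝ f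

/-- `Vect(ℝ^{2l+1|n})`: sums of an even and an odd superderivation of the superfunctions. -/
def vect (l n : ℕ) : Submodule ℝ (Module.End ℝ (SFun l n)) :=
  superDer (SFun l n) 0 ⊔ superDer (SFun l n) 1

/-! ### The standard contact structure -/

/-- The matrix `(ω_{rs})`. -/
def omega (l n : ℕ) : Matrix (QIdx l n) (QIdx l n) ℝ :=
  Matrix.fromBlocks (Matrix.fromBlocks 0 1 (-1) 0) 0 0 1

/-- The inverse matrix `(ω^{rs})`. -/
def omegaInv (l n : ℕ) : Matrix (QIdx l n) (QIdx l n) ℝ :=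
  Matrix.fromBlocks (Matrix.fromBlocks 0 (-1) 1 0) 0 0 1

theorem omega_mul_omegaInv (l n : ℕ) : omega l n * omegaInv l n = 1 := by
  simp [omega, omegaInv, Matrix.fromBlocks_multiply]

/-- The components `α_i` of the contact form `α = ∑ α_i dt^i = dz + ∑ ω_{rs} q^r dq^s`. -/
def contactForm {l n : ℕ} : Idx l n → SFun l n
  | Sum.inl none => 1
  | Sum.inl (some s) => ∑ r, omega l n r (Sum.inl s) • coord (QIdx.toIdx r)
  | Sum.inr s => ∑ r, omega l n r (Sum.inr s) • coord (QIdx.toIdx r)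

/-- The pairing `⟨X, β⟩ = ∑ (-1)^(|i| (|β_i| + |i|)) X^i β_i` of a vector field
`X = ∑ X^i ∂_{t^i}`, whose components are `X^i = X(t^i)`, and a `1`-form `β = ∑ β_i dt^i`. -/
def pairing {l n : ℕ} (β : Idx l n → SFun l n) : Module.End ℝ (SFun l n) →ₗ[ℝ] SFun l n where
  toFun X := ∑ i, (-1 : ℝ) ^ (parity i * parity i) •
    (X (coord i) * (SuperAlgebra.par (A := SFun l n))^[parity i] (β i))
  map_add' X Y := by
    simp only [LinearMap.add_apply, add_mul, smul_add, Finset.sum_add_distrib]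
  map_smul' c X := by
    simp only [LinearMap.smul_apply, smul_mul_assoc, Finset.smul_sum, RingHom.id_apply,
      smul_comm c]

/-- `Tan(ℝ^{2l+1|n})`, the kernel of the contact form on vector fields. -/
def tan (l n : ℕ) : Submodule ℝ (Module.End ℝ (SFun l n)) :=
  vect l n ⊓ LinearMap.ker (pairing contactForm)

/-- `K(2l+1|n)`: vector fields `X` with `[X, T] ∈ Tan` for all `T ∈ Tan`. -/
def contactVect (l n : ℕ) : Submodule ℝ (Module.End ℝ (SFun l n)) where
  carrier := {X | X ∈ vect l n ∧ ∀ T ∈ tan l n, LieSuperalgebra.bracket X T ∈ tan l n}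
  zero_mem' := ⟨zero_mem _, fun T _ => by simp⟩
  add_mem' := fun ha hb => ⟨add_mem ha.1 hb.1, fun T hT => by
    rw [map_add]; exact add_mem (ha.2 T hT) (hb.2 T hT)⟩
  smul_mem' := fun c _ ha => ⟨Submodule.smul_mem _ c ha.1, fun T hT => by
    rw [map_smul]; exact Submodule.smul_mem _ c (ha.2 T hT)⟩

/-- The fields `T_r = ∂_{q^r} - ∑_k ω_{kr} q^k ∂_z`. -/
def T {l n : ℕ} (r : QIdx l n) : Module.End ℝ (SFun l n) :=
  del (QIdx.toIdx r) - ∑ k, omega l n k r • (lmul (coord (QIdx.toIdx k)) * del (zIdx l n))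

/-- `X_f = f ∂_z - 1/2 ∑ (-1)^(|f| |T_r|) ω^{rs} T_r(f) T_s`, extended linearly in `f`. -/
def X {l n : ℕ} : SFun l n →ₗ[ℝ] Module.End ℝ (SFun l n) where
  toFun f := lmul f * del (zIdx l n) - (1 / 2 : ℝ) • ∑ r, ∑ s, omegaInv l n r s •
    (lmul (T r ((SuperAlgebra.par (A := SFun l n) ^ parity r) f)) * T s)
  map_add' f g := by
    have h : ∀ f g : SFun l n, lmul (f + g) = lmul f + lmul g := fun f g => by
      ext1; simp [add_mul]
    simp only [map_add, h, add_mul, smul_add, Finset.sum_add_distrib]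
    abel
  map_smul' c f := by
    have h : ∀ f : SFun l n, lmul (c • f) = c • lmul f := fun f => by
      ext1; simp
    simp only [map_smul, h, smul_mul_assoc, smul_sub, Finset.smul_sum, RingHom.id_apply,
      smul_comm c]

/-- Superfunctions that are polynomials of degree at most two in the coordinates `z, x, y, θ`. -/
def degLETwo (l n : ℕ) : Submodule ℝ (SFun l n) :=
  Submodule.span ℝ ({1} ∪ Set.range coord ∪ Set.range fun ij : Idx l n × Idx l n =>
    coord ij.1 * coord ij.2)

/-- The space `𝔤` of the fields `X_f` with `f` of degree at most two. -/
def quadContact (l n : ℕ) : Submodule ℝ (Module.End ℝ (SFun l n)) := (degLETwo l n).map X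

/-! ### `gl`, `pgl`, `spo` and the projective embedding -/

/-- Index set of `ℝ^{2l+2|n}`. -/
abbrev HIdx (l n : ℕ) := (Fin (l + 1) ⊕ Fin (l + 1)) ⊕ Fin n

/-- `gl(2l+2|n)`. -/
abbrev gl (l n : ℕ) := Matrix (HIdx l n) (HIdx l n) ℝ

/-- The diagonal matrix with entries `(-1)^|i|`. -/
def signMat (l n : ℕ) : gl l n := Matrix.diagonal fun i => (-1 : ℝ) ^ parity i

theorem signMat_mul_self (l n : ℕ) : signMat l n * signMat l n = 1 := by
  rw [signMat, Matrix.diagonal_mul_diagonal, ← Matrix.diagonal_one]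
  congr 1; funext i; rw [← mul_pow]; simp

/-- The block-diagonal matrices are even and the block-antidiagonal ones odd. -/
instance (l n : ℕ) : SuperAlgebra (gl l n) where
  par := AlgHom.ofLinearMap (LinearMap.mulLeftRight ℝ (signMat l n, signMat l n))
    (by simp [signMat_mul_self])
    (by
      intro A B
      simp only [LinearMap.mulLeftRight_apply]
      calc signMat l n * (A * B) * signMat l n
          = signMat l n * A * 1 * (B * signMat l n) := by simp only [mul_one, mul_assoc]
        _ = _ := by rw [← signMat_mul_self]; simp only [mul_assoc])
  par_par := by
    intro A
    change signMat l n * (signMat l n * A * signMat l n) * signMat l n = A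
    calc signMat l n * (signMat l n * A * signMat l n) * signMat l n
        = (signMat l n * signMat l n) * A * (signMat l n * signMat l n) := by
          simp only [mul_assoc]
      _ = A := by simp [signMat_mul_self]

theorem par_gl_apply (l n : ℕ) (A : gl l n) (i j : HIdx l n) :
    SuperAlgebra.par A i j = (-1 : ℝ) ^ (parity i + parity j) * A i j := by
  change (signMat l n * A * signMat l n) i j = _
  rw [signMat, Matrix.mul_diagonal, Matrix.diagonal_mul, pow_add]; ring

/-- `G = diag(J, id_n)` with `J = (0, -id; id, 0)`. -/
def G (l n : ℕ) : gl l n := Matrix.fromBlocks (Matrix.J (Fin (l + 1)) ℝ) 0 0 1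

/-- The form `ω(U, V) = Vᵗ G U`. -/
def form {l n : ℕ} (U V : HIdx l n → ℝ) : ℝ := V ⬝ᵥ (G l n).mulVec U

/-- `U` is homogeneous of parity `q`. -/
def IsHomogVec {l n : ℕ} (q : ℕ) (U : HIdx l n → ℝ) : Prop :=
  ∀ i, (-1 : ℝ) ^ parity i * U i = (-1 : ℝ) ^ q * U i

theorem homPart_add {L : Type*} [AddCommGroup L] [Module ℝ L] [LieSuperalgebra L] (p : ℕ)
    (x y : L) : homPart p (x + y) = homPart p x + homPart p y := by
  simp only [homPart, map_add, smul_add]; abel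

theorem homPart_smul {L : Type*} [AddCommGroup L] [Module ℝ L] [LieSuperalgebra L] (p : ℕ)
    (c : ℝ) (x : L) : homPart p (c • x) = c • homPart p x := by
  simp only [homPart, map_smul, smul_add, smul_comm c]

/-- `spo(2l+2|n)`: matrices all of whose homogeneous parts `A` satisfy
`ω(AU, V) + (-1)^(|A| |U|) ω(U, AV) = 0` for all homogeneous `U` and all `V`. -/
def spo (l n : ℕ) : Submodule ℝ (gl l n) where
  carrier := {A | ∀ (p q : ℕ) (U V : HIdx l n → ℝ), IsHomogVec q U →
    form ((homPart p A).mulVec U) V + (-1 : ℝ) ^ (p * q) * form U ((homPart p A).mulVec V) = 0}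
  zero_mem' := by
    intro p q U V _
    simp [homPart, form]
  add_mem' := by
    intro A B hA hB p q U V hU
    have h1 := hA p q U V hU
    have h2 := hB p q U V hU
    simp only [homPart_add, form, Matrix.add_mulVec, Matrix.mulVec_add, dotProduct_add,
      add_dotProduct] at h1 h2 ⊢
    linear_combination h1 + h2
  smul_mem' := by
    intro c A hA p q U V hU
    have h1 := hA p q U V hU
    simp only [homPart_smul, form, Matrix.smul_mulVec, Matrix.mulVec_smul, dotProduct_smul,
      smul_dotProduct, smul_eq_mul] at h1 ⊢
    linear_combination c * h1

/-- `pgl(2l+2|n) = gl(2l+2|n) / ℝ Id`. -/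
abbrev pgl (l n : ℕ) := gl l n ⧸ scalars (gl l n)

/-- The map `A ↦ [A]` from `spo(2l+2|n)` to `pgl(2l+2|n)`. -/
def spoToPgl (l n : ℕ) : spo l n →ₗ[ℝ] pgl l n := (scalars (gl l n)).mkQ ∘ₗ (spo l n).subtype

/-- The first index of `ℝ^{2l+2|n}`. -/
def h0 (l n : ℕ) : HIdx l n := Sum.inl (Sum.inl 0)

/-- The index of `ℝ^{2l+2|n}` corresponding to an affine coordinate, in the order
(first index), `x_1, …, x_l`, `z`, `y_1, …, y_l`, `θ_1, …, θ_n`. -/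
def affIdx {l n : ℕ} : Idx l n → HIdx l n
  | Sum.inl none => Sum.inl (Sum.inr 0)
  | Sum.inl (some (Sum.inl i)) => Sum.inl (Sum.inl i.succ)
  | Sum.inl (some (Sum.inr i)) => Sum.inl (Sum.inr i.succ)
  | Sum.inr j => Sum.inr j

/-- The vector field
`-∑ v^i ∂_i - ∑ (-1)^(|j|(|i|+|j|)) B^i_j t^j ∂_i + ∑ (-1)^|j| ξ_j t^j t^i ∂_i` attached to a matrix
with blocks `(0, ξ; v, B)`. -/
def projField {l n : ℕ} (C : gl l n) : Module.End ℝ (SFun l n) :=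
  -∑ i : Idx l n, C (affIdx i) (h0 l n) • del i
  - ∑ i : Idx l n, ∑ j : Idx l n, ((-1 : ℝ) ^ (parity j * (parity i + parity j)) *
      C (affIdx i) (affIdx j)) • (lmul (coord j) * del i)
  + ∑ i : Idx l n, ∑ j : Idx l n, ((-1 : ℝ) ^ parity j * C (h0 l n) (affIdx j)) •
      (lmul (coord j * coord i) * del i)

/-- The projective embedding on representatives: `A` is replaced by the representative
`A - A₀₀ Id` of its class, whose upper left entry vanishes. -/
def projLin (l n : ℕ) : gl l n →ₗ[ℝ] Module.End ℝ (SFun l n) where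
  toFun A := projField (A - A (h0 l n) (h0 l n) • 1)
  map_add' A B := by
    have h : A + B - (A + B) (h0 l n) (h0 l n) • (1 : gl l n) =
        (A - A (h0 l n) (h0 l n) • 1) + (B - B (h0 l n) (h0 l n) • 1) := by
      rw [Matrix.add_apply, add_smul]; abel
    rw [h]
    simp only [projField, Matrix.add_apply, mul_add, add_smul, Finset.sum_add_distrib]
    abel
  map_smul' c A := by
    have h : c • A - (c • A) (h0 l n) (h0 l n) • (1 : gl l n) =
        c • (A - A (h0 l n) (h0 l n) • 1) := by
      rw [Matrix.smul_apply, smul_sub, smul_smul, smul_eq_mul]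
    rw [h]
    simp only [projField, Matrix.smul_apply, smul_eq_mul, smul_add, smul_sub, smul_neg,
      Finset.smul_sum, smul_smul, RingHom.id_apply, mul_left_comm c]

/-- The projective embedding `pgl(2l+2|n) → Vect(ℝ^{2l+1|n})`. -/
def projEmb (l n : ℕ) : pgl l n →ₗ[ℝ] Module.End ℝ (SFun l n) :=
  (scalars (gl l n)).liftQ (projLin l n) (by
    rw [Submodule.span_le]
    rintro _ rfl
    change projField ((1 : gl l n) - (1 : gl l n) (h0 l n) (h0 l n) • 1) = 0
    rw [Matrix.one_apply_eq, one_smul, sub_self]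
    simp [projField])

/-- The projective vector fields: the image of `pgl(2l+2|n)`. -/
def projVect (l n : ℕ) : Submodule ℝ (Module.End ℝ (SFun l n)) := LinearMap.range (projEmb l n)

end SuperContact

end

/-! Everything is computed in homogeneous coordinates `t^a`, with `a` ranging over the `2l+2|n`
indices, restricted to the chart `t^0 = 1`. A superfunction on the chart is a homogeneous function
of degree zero, so Euler's relation forces `∂_0 = -E`, where `E` is the Euler field of the affine
coordinates. With `hcoord a = t^a` and `hdel a = ∂_a`, the three parts of the projective embedding
merge into one formula, `P(A) = -∑ ± A_ij t^j ∂_i` (`projLin_apply`). The fields `t^j ∂_i` satisfy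
the bracket relations of `gl` (`superComm_hgen`), so `P` is a morphism. If `P(A) = 0`, then
differentiating the quadratic polynomials `P(A)(t^c)` shows that `A` is scalar (`projLin_eq_zero`).

The matrix `G` is even with inverse its transpose. Writing `A = G N` turns membership in `spo` into
supersymmetry of `N` up to signs (`G_mul_mem_spo_iff`) and turns `P(A)` into a combination of the
fields `t^a D_b`, where `D_b = ∑ G_cb ∂_c` (`projLin_G_mul`). On the contact side, `t^0 = 1` makes
the polynomials of degree at most two the span of the products `t^a t^b`, and `X_{t^a t^b} = 1/2
(t^a D_b ± t^b D_a)` (`X_hcoord_mul`). Supersymmetric coefficient matrices thus describe both sides,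
so `P` maps `spo` onto `𝔤` (`map_projLin_spo`). In particular `𝔤` inherits closure under the bracket
from `spo`, which is the set where the two Lie automorphisms `A ↦ -Aˢᵗ` and `A ↦ G A G⁻¹` agree.

For contactness, `α` has homogeneous components `α_e = ∑ G_ec t^c`. The field `X_{t^a t^b}` acts on
the `t^c` as an infinitesimal linear symplectic map minus a multiple `λ t^c`, hence rescales `α`.
The direct computation is `pairing_superComm_eq_zero`. -/

noncomputable section

namespace SuperContact

/-! ### Superfunctions -/

section SFunBasics

variable {l n : ℕ}

/-- The elementary tensor `f ⊗ w` as a superfunction. -/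
def SFun.mk (f : Smooth l) (w : ExteriorAlgebra ℝ (Fin n → ℝ)) : SFun l n := f ⊗ₜ[ℝ] w

theorem SFun.induction {P : SFun l n → Prop} (hmk : ∀ f w, P (SFun.mk f w))
    (hadd : ∀ a b, P a → P b → P (a + b)) (a : SFun l n) : P a := by
  refine TensorProduct.induction_on a ?_ hmk hadd
  have := hmk 0 0
  rwa [SFun.mk, TensorProduct.zero_tmul] at this

theorem SFun.mk_mul_mk (f g : Smooth l) (v w : ExteriorAlgebra ℝ (Fin n → ℝ)) :
    SFun.mk f v * SFun.mk g w = SFun.mk (f * g) (v * w) :=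
  Algebra.TensorProduct.tmul_mul_tmul f g v w

theorem SFun.mk_add_left (f g : Smooth l) (w : ExteriorAlgebra ℝ (Fin n → ℝ)) :
    SFun.mk (f + g) w = SFun.mk f w + SFun.mk g w := TensorProduct.add_tmul f g w

theorem SFun.mk_add_right (f : Smooth l) (v w : ExteriorAlgebra ℝ (Fin n → ℝ)) :
    SFun.mk f (v + w) = SFun.mk f v + SFun.mk f w := TensorProduct.tmul_add f v w

theorem SFun.mk_neg (f : Smooth l) (w : ExteriorAlgebra ℝ (Fin n → ℝ)) :
    SFun.mk f (-w) = -SFun.mk f w := TensorProduct.tmul_neg f w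

theorem SFun.mk_zero_left (w : ExteriorAlgebra ℝ (Fin n → ℝ)) :
    SFun.mk (0 : Smooth l) w = 0 := TensorProduct.zero_tmul _ w

theorem SFun.mk_zero_right (f : Smooth l) :
    SFun.mk f (0 : ExteriorAlgebra ℝ (Fin n → ℝ)) = 0 := TensorProduct.tmul_zero _ f

theorem SFun.mk_one_one : SFun.mk (1 : Smooth l) (1 : ExteriorAlgebra ℝ (Fin n → ℝ)) = 1 := rfl

theorem SFun.par_mk (f : Smooth l) (w : ExteriorAlgebra ℝ (Fin n → ℝ)) :
    SuperAlgebra.par (SFun.mk f w) = SFun.mk f (CliffordAlgebra.involute w) := rfl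

/-- The coordinate function `x ↦ x e`. -/
def smoothCoord (e : EvenIdx l) : Smooth l :=
  ⟨fun x => x e, (contDiff_apply ℝ ℝ e).contMDiff⟩

theorem coord_inl (e : EvenIdx l) :
    (coord (Sum.inl e) : SFun l n) = SFun.mk (smoothCoord e) 1 := rfl

theorem coord_inr (j : Fin n) :
    (coord (Sum.inr j) : SFun l n) = SFun.mk 1 (ExteriorAlgebra.ι ℝ (Pi.single j 1)) := rfl

theorem del_inl_mk (e : EvenIdx l) (f : Smooth l) (w : ExteriorAlgebra ℝ (Fin n → ℝ)) :
    del (Sum.inl e) (SFun.mk f w) = SFun.mk (smoothDeriv e f) w := rfl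

/-- Contraction of exterior forms with the `j`-th coordinate form. -/
def extDeriv (j : Fin n) : Module.End ℝ (ExteriorAlgebra ℝ (Fin n → ℝ)) :=
  CliffordAlgebra.contractLeft (LinearMap.proj j)

theorem del_inr_mk (j : Fin n) (f : Smooth l) (w : ExteriorAlgebra ℝ (Fin n → ℝ)) :
    del (Sum.inr j) (SFun.mk f w) = SFun.mk f (extDeriv j w) := rfl

/-- Evaluation at the origin, combined with the augmentation of the exterior algebra, is a ring map
to `ℝ`. Nontriviality is what allows coefficients of `1` to be read off in `projLin_eq_zero`. -/
instance : Nontrivial (SFun l n) := by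
  let ev : Smooth l →ₐ[ℝ] ℝ :=
    { toFun := fun f => f 0
      map_one' := rfl
      map_mul' := fun _ _ => rfl
      map_zero' := rfl
      map_add' := fun _ _ => rfl
      commutes' := fun _ => rfl }
  let φ : SFun l n →ₐ[ℝ] ℝ :=
    (Algebra.TensorProduct.lift ev (ExteriorAlgebra.algebraMapInv (M := Fin n → ℝ))
      fun _ _ => mul_comm _ _)
  exact φ.toRingHom.domain_nontrivial

theorem smoothDeriv_mul (e : EvenIdx l) (f g : Smooth l) :
    smoothDeriv e (f * g) = smoothDeriv e f * g + f * smoothDeriv e g := by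
  ext x
  have hf : DifferentiableAt ℝ f x := (f.contMDiff.contDiff.differentiable (by simp)) x
  have hg : DifferentiableAt ℝ g x := (g.contMDiff.contDiff.differentiable (by simp)) x
  change fderiv ℝ ((f : (EvenIdx l → ℝ) → ℝ) * (g : (EvenIdx l → ℝ) → ℝ)) x _ =
    fderiv ℝ f x _ * g x + f x * fderiv ℝ g x _
  rw [fderiv_mul hf hg]
  simp only [add_apply, smul_apply, smul_eq_mul]
  ring

theorem smoothDeriv_one (e : EvenIdx l) : smoothDeriv e (1 : Smooth l) = 0 := by
  have h := smoothDeriv_mul e (1 : Smooth l) 1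
  rw [mul_one, mul_one, one_mul] at h
  exact left_eq_add.mp h

theorem smoothDeriv_smoothCoord (e e' : EvenIdx l) :
    smoothDeriv e (smoothCoord e') = if e = e' then 1 else 0 := by
  ext x
  change fderiv ℝ (fun x : EvenIdx l → ℝ => x e') x (Pi.single e 1) = _
  have h : HasFDerivAt (fun x : EvenIdx l → ℝ => x e')
      (ContinuousLinearMap.proj (R := ℝ) (φ := fun _ : EvenIdx l => ℝ) e') x :=
    (ContinuousLinearMap.proj (R := ℝ) (φ := fun _ : EvenIdx l => ℝ) e').hasFDerivAt
  rw [h.fderiv]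
  by_cases h' : e = e'
  · subst h'; simp
  · simp [h', Ne.symm h']

theorem smoothDeriv_comm (e e' : EvenIdx l) (f : Smooth l) :
    smoothDeriv e (smoothDeriv e' f) = smoothDeriv e' (smoothDeriv e f) := by
  ext x
  have hf : ContDiff ℝ ∞ f := f.contMDiff.contDiff
  have hd : DifferentiableAt ℝ (fderiv ℝ f) x :=
    (hf.fderiv_right (m := ∞) le_rfl).differentiable (by simp) x
  have key : ∀ v w : EvenIdx l → ℝ,
      fderiv ℝ (fun y => fderiv ℝ f y v) x w = fderiv ℝ (fderiv ℝ f) x w v := by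
    intro v w
    rw [fderiv_clm_apply hd (by fun_prop)]
    simp
  change fderiv ℝ (fun y => fderiv ℝ f y (Pi.single e' 1)) x (Pi.single e 1) =
    fderiv ℝ (fun y => fderiv ℝ f y (Pi.single e 1)) x (Pi.single e' 1)
  rw [key, key]
  exact (hf.contDiffAt.isSymmSndFDerivAt (by
    rw [minSmoothness_of_isRCLikeNormedField]; exact WithTop.coe_le_coe.2 (le_top : (2 : ℕ∞) ≤ ⊤))) _ _

theorem extDeriv_ι (j : Fin n) (m : Fin n → ℝ) :
    extDeriv j (ExteriorAlgebra.ι ℝ m) = algebraMap ℝ _ (m j) := by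
  rw [extDeriv, CliffordAlgebra.contractLeft_ι, LinearMap.proj_apply]

theorem extDeriv_mul (j : Fin n) (v w : ExteriorAlgebra ℝ (Fin n → ℝ)) :
    extDeriv j (v * w) = extDeriv j v * w + CliffordAlgebra.involute v * extDeriv j w := by
  induction v using CliffordAlgebra.left_induction with
  | algebraMap r =>
    simp [extDeriv, CliffordAlgebra.contractLeft_algebraMap_mul,
      CliffordAlgebra.contractLeft_algebraMap]
  | add x y hx hy => simp only [add_mul, map_add, hx, hy]; abel
  | ι_mul x m hx =>
    simp only [extDeriv] at hx ⊢
    rw [mul_assoc, CliffordAlgebra.contractLeft_ι_mul, CliffordAlgebra.contractLeft_ι_mul, hx,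
      map_mul, CliffordAlgebra.involute_ι]
    simp only [mul_add, sub_mul, smul_mul_assoc, mul_assoc, neg_mul]
    abel

theorem involute_extDeriv (j : Fin n) (w : ExteriorAlgebra ℝ (Fin n → ℝ)) :
    CliffordAlgebra.involute (extDeriv j w) = -extDeriv j (CliffordAlgebra.involute w) := by
  induction w using CliffordAlgebra.left_induction with
  | algebraMap r => simp [extDeriv, CliffordAlgebra.contractLeft_algebraMap]
  | add x y hx hy => simp only [map_add, hx, hy, neg_add]
  | ι_mul x m hx =>
    simp only [extDeriv] at hx ⊢
    rw [CliffordAlgebra.contractLeft_ι_mul, map_sub, map_smul, map_mul, map_mul, hx,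
      CliffordAlgebra.involute_ι, neg_mul, neg_mul, map_neg, CliffordAlgebra.contractLeft_ι_mul]
    simp

/-- Generators anticommute, so passing one through a word costs one sign per letter, which is what
`involute` records. This is the supercommutativity of the odd coordinates. -/
theorem ι_mul_eq (m : Fin n → ℝ) (w : ExteriorAlgebra ℝ (Fin n → ℝ)) :
    ExteriorAlgebra.ι ℝ m * w = CliffordAlgebra.involute w * ExteriorAlgebra.ι ℝ m := by
  induction w using CliffordAlgebra.left_induction with
  | algebraMap r => simp [Algebra.commutes]
  | add x y hx hy => simp only [mul_add, add_mul, map_add, hx, hy]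
  | ι_mul x m' hx =>
    have h : ExteriorAlgebra.ι ℝ m * ExteriorAlgebra.ι ℝ m' =
        -(ExteriorAlgebra.ι ℝ m' * ExteriorAlgebra.ι ℝ m) :=
      eq_neg_of_add_eq_zero_left (ExteriorAlgebra.ι_add_mul_swap m m')
    change ExteriorAlgebra.ι ℝ m * (ExteriorAlgebra.ι ℝ m' * x) = _
    rw [← mul_assoc, h, map_mul, CliffordAlgebra.involute_ι, neg_mul, mul_assoc, hx, neg_mul,
      neg_mul, mul_assoc]

/-- The partial derivatives are superderivations. -/
theorem del_mem_superDer (i : Idx l n) : del i ∈ superDer (SFun l n) (parity i) := by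
  rcases i with e | j
  · refine ⟨?_, fun f g => ?_⟩
    · ext a
      rw [par_end_apply]
      induction a using SFun.induction with
      | hmk f w =>
        simp [SFun.par_mk, del_inl_mk, parity, CliffordAlgebra.involute_involute]
      | hadd a b ha hb => simp only [map_add, ha, hb]
    · change del _ (f * g) = del _ f * g + f * del _ g
      induction f using SFun.induction with
      | hadd a b ha hb => simp only [map_add, add_mul, ha, hb]; abel
      | hmk f v =>
        induction g using SFun.induction with
        | hadd a b ha hb => simp only [map_add, mul_add, ha, hb]; abel
        | hmk g w =>
          simp only [SFun.mk_mul_mk, del_inl_mk, smoothDeriv_mul, SFun.mk_add_left]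
  · refine ⟨?_, fun f g => ?_⟩
    · ext a
      rw [par_end_apply]
      induction a using SFun.induction with
      | hmk f w =>
        simp [SFun.par_mk, del_inr_mk, parity, involute_extDeriv,
          CliffordAlgebra.involute_involute, SFun.mk_neg]
      | hadd a b ha hb => simp only [map_add, ha, hb]
    · change del _ (f * g) = del _ f * g + SuperAlgebra.par f * del _ g
      induction f using SFun.induction with
      | hadd a b ha hb => simp only [map_add, add_mul, ha, hb]; abel
      | hmk f v =>
        induction g using SFun.induction with
        | hadd a b ha hb => simp only [map_add, mul_add, ha, hb]; abel
        | hmk g w =>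
          simp only [SFun.mk_mul_mk, del_inr_mk, SFun.par_mk, extDeriv_mul, SFun.mk_add_right]

theorem del_coord (i j : Idx l n) : del i (coord j : SFun l n) = if i = j then 1 else 0 := by
  rcases i with e | i <;> rcases j with e' | j
  · rw [coord_inl, del_inl_mk, smoothDeriv_smoothCoord]
    by_cases h : e = e'
    · simp [h, SFun.mk_one_one]
    · simp [h, SFun.mk_zero_left]
  · simp [coord_inr, del_inl_mk, smoothDeriv_one, SFun.mk_zero_left]
  · simp [coord_inl, del_inr_mk, extDeriv, CliffordAlgebra.contractLeft_one, SFun.mk_zero_right]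
  · have h : extDeriv i (ExteriorAlgebra.ι ℝ (Pi.single j 1)) = if i = j then 1 else 0 := by
      rw [extDeriv_ι]
      by_cases h : i = j
      · subst h; simp
      · simp [h]
    rw [coord_inr, del_inr_mk, h]
    by_cases h : i = j
    · simp [h, SFun.mk_one_one]
    · simp [h, SFun.mk_zero_right]

theorem del_comm (i j : Idx l n) :
    (del i * del j : Module.End ℝ (SFun l n)) = (-1 : ℝ) ^ (parity i * parity j) • (del j * del i) := by
  ext a
  simp only [Module.End.mul_apply, LinearMap.smul_apply]
  induction a using SFun.induction with
  | hadd a b ha hb => simp only [map_add, smul_add, ha, hb]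
  | hmk f w =>
    rcases i with e | i <;> rcases j with e' | j <;>
      simp only [del_inl_mk, del_inr_mk, parity, Sum.elim_inl, Sum.elim_inr, mul_zero, mul_one,
        pow_zero, pow_one, one_smul, neg_smul]
    · rw [smoothDeriv_comm]
    · rw [extDeriv, extDeriv, CliffordAlgebra.contractLeft_comm, SFun.mk_neg]

end SFunBasics

/-! ### Superderivations -/

section SuperDerivations

theorem parity_eq_zero_or_one {α β : Type*} (i : α ⊕ β) : parity i = 0 ∨ parity i = 1 := by
  rcases i with i | i
  · exact Or.inl rfl
  · exact Or.inr rfl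

theorem neg_one_pow_mul_self (p : ℕ) : (-1 : ℝ) ^ p * (-1 : ℝ) ^ p = 1 := by
  rw [← mul_pow]; simp

variable {A : Type*} [Ring A] [Algebra ℝ A] [SuperAlgebra A]

theorem par_iterate_add_two (p : ℕ) (a : A) :
    (SuperAlgebra.par (A := A))^[p + 2] a = (SuperAlgebra.par (A := A))^[p] a := by
  rw [Function.iterate_add_apply]
  exact congrArg _ (SuperAlgebra.par_par a)

theorem par_iterate_of_homog (p q : ℕ) (a : A) (ha : SuperAlgebra.par a = (-1 : ℝ) ^ q • a) :
    (SuperAlgebra.par (A := A))^[p] a = (-1 : ℝ) ^ (p * q) • a := by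
  induction p with
  | zero => simp
  | succ p ih =>
    rw [Function.iterate_succ_apply', ih, map_smul, ha, smul_smul, ← pow_add, add_mul, one_mul]

theorem superDer_add_two (p : ℕ) : superDer A (p + 2) = superDer A p := by
  ext D
  change (_ ∧ _) ↔ (_ ∧ _)
  simp only [par_iterate_add_two, pow_add, even_two.neg_one_pow, mul_one]

theorem superDer_add_two_mul (p k : ℕ) : superDer A (p + 2 * k) = superDer A p := by
  induction k with
  | zero => rfl
  | succ k ih => rw [mul_add, mul_one, ← add_assoc, superDer_add_two, ih]

/-- Parities are natural numbers that add without reduction; only their class modulo two matters. -/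
theorem superDer_congr {p q : ℕ} (h : p % 2 = q % 2) : superDer A p = superDer A q := by
  rw [← Nat.mod_add_div p 2, ← Nat.mod_add_div q 2, superDer_add_two_mul, superDer_add_two_mul, h]

theorem superDer_mul_of_homog {p q : ℕ} {D : Module.End ℝ A} (hD : D ∈ superDer A p) {f : A}
    (hf : SuperAlgebra.par f = (-1 : ℝ) ^ q • f) (g : A) :
    D (f * g) = D f * g + (-1 : ℝ) ^ (p * q) • (f * D g) := by
  rw [hD.2, par_iterate_of_homog p q f hf, smul_mul_assoc]

theorem superDer_one {p : ℕ} {D : Module.End ℝ A} (hD : D ∈ superDer A p) : D 1 = 0 := by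
  have h := superDer_mul_of_homog (q := 0) hD (f := 1) (by simp) 1
  simpa using h

theorem superDer_par_apply {p : ℕ} {D : Module.End ℝ A} (hD : D ∈ superDer A p) (f : A) :
    SuperAlgebra.par (D f) = (-1 : ℝ) ^ p • D (SuperAlgebra.par f) := by
  have h := congrArg (fun E : Module.End ℝ A => E (SuperAlgebra.par f)) hD.1
  simpa only [par_end_apply, SuperAlgebra.par_par, LinearMap.smul_apply] using h

theorem superDer_apply_homog {p q : ℕ} {D : Module.End ℝ A} (hD : D ∈ superDer A p) {f : A}
    (hf : SuperAlgebra.par f = (-1 : ℝ) ^ q • f) :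
    SuperAlgebra.par (D f) = (-1 : ℝ) ^ (p + q) • D f := by
  rw [superDer_par_apply hD, hf, map_smul, smul_smul, pow_add]

theorem superDer_par_iterate {p : ℕ} {D : Module.End ℝ A} (hD : D ∈ superDer A p) (q : ℕ) (f : A) :
    D ((SuperAlgebra.par (A := A))^[q] f) =
      (-1 : ℝ) ^ (p * q) • (SuperAlgebra.par (A := A))^[q] (D f) := by
  induction q with
  | zero => simp
  | succ q ih =>
    rw [Function.iterate_succ_apply', Function.iterate_succ_apply']
    have h := superDer_par_apply hD ((SuperAlgebra.par (A := A))^[q] f)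
    rw [ih, map_smul] at h
    rw [mul_add, mul_one, pow_add, mul_comm ((-1 : ℝ) ^ (p * q)), mul_smul, h, smul_smul,
      neg_one_pow_mul_self, one_smul]

/-- The mixed terms, in which `D` and `E` hit different factors, cancel: moving the parity
involution past a derivation (`superDer_par_iterate`) produces exactly the sign `(-1)^(pq)` of the
supercommutator. -/
theorem superComm_mem_superDer {p q : ℕ} {D E : Module.End ℝ A} (hD : D ∈ superDer A p)
    (hE : E ∈ superDer A q) : superComm D E ∈ superDer A (p + q) := by
  have hs := superComm_homog p q D E hD.1 hE.1
  refine ⟨?_, fun f g => ?_⟩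
  · rw [par_superComm, hD.1, hE.1, map_smul, map_smul, LinearMap.smul_apply, smul_smul, pow_add,
      mul_comm]
  · simp only [hs, LinearMap.sub_apply, LinearMap.smul_apply, Module.End.mul_apply]
    rw [hE.2, hD.2, map_add, map_add, hD.2, hD.2, hE.2, hE.2, superDer_par_iterate hD,
      superDer_par_iterate hE, ← Function.iterate_add_apply, ← Function.iterate_add_apply,
      add_comm q p]
    simp only [smul_add, smul_mul_assoc, mul_sub, sub_mul, mul_smul_comm, smul_smul, mul_comm q p,
      neg_one_pow_mul_self, one_smul]
    abel

end SuperDerivations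

/-! ### Vector fields -/

section VectorFields

variable {l n : ℕ}

theorem superDer_le_vect (p : ℕ) : superDer (SFun l n) p ≤ vect l n := by
  rcases Nat.mod_two_eq_zero_or_one p with h | h
  · rw [superDer_congr (q := 0) h]; exact le_sup_left
  · rw [superDer_congr (q := 1) h]; exact le_sup_right

theorem bracket_mem_vect {D E : Module.End ℝ (SFun l n)} (hD : D ∈ vect l n) (hE : E ∈ vect l n) :
    superComm D E ∈ vect l n := by
  obtain ⟨D0, hD0, D1, hD1, rfl⟩ := Submodule.mem_sup.1 hD
  obtain ⟨E0, hE0, E1, hE1, rfl⟩ := Submodule.mem_sup.1 hE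
  simp only [map_add, LinearMap.add_apply]
  exact add_mem
    (add_mem (superDer_le_vect _ (superComm_mem_superDer hD0 hE0))
      (superDer_le_vect _ (superComm_mem_superDer hD1 hE0)))
    (add_mem (superDer_le_vect _ (superComm_mem_superDer hD0 hE1))
      (superDer_le_vect _ (superComm_mem_superDer hD1 hE1)))

variable (l n) in
/-- Superfunctions of parity `p` that supercommute with every superfunction. -/
def superCenter (p : ℕ) : Submodule ℝ (SFun l n) where
  carrier := {f | SuperAlgebra.par f = (-1 : ℝ) ^ p • f ∧
    ∀ g, f * g = (SuperAlgebra.par (A := SFun l n))^[p] g * f}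
  zero_mem' := by simp
  add_mem' := by
    rintro f f' ⟨h1, h2⟩ ⟨h1', h2'⟩
    exact ⟨by rw [map_add, h1, h1', smul_add], fun g => by rw [add_mul, mul_add, h2, h2']⟩
  smul_mem' := by
    rintro c f ⟨h1, h2⟩
    exact ⟨by rw [map_smul, h1, smul_comm],
      fun g => by rw [smul_mul_assoc, mul_smul_comm, h2]⟩

theorem one_mem_superCenter : (1 : SFun l n) ∈ superCenter l n 0 :=
  ⟨by simp, fun g => by simp⟩

theorem coord_mem_superCenter (i : Idx l n) : coord i ∈ superCenter l n (parity i) := by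
  rcases i with e | j
  · refine ⟨by simp [coord_inl, SFun.par_mk, parity], fun g => ?_⟩
    change _ = g * _
    induction g using SFun.induction with
    | hadd a b ha hb => rw [mul_add, add_mul, ha, hb]
    | hmk f w =>
      rw [coord_inl, SFun.mk_mul_mk, SFun.mk_mul_mk, one_mul, mul_one, mul_comm]
  · refine ⟨?_, fun g => ?_⟩
    · rw [coord_inr, SFun.par_mk]
      change SFun.mk 1 (CliffordAlgebra.involute (CliffordAlgebra.ι 0 _)) = _
      rw [CliffordAlgebra.involute_ι, SFun.mk_neg]
      simp [parity]
    · change _ = SuperAlgebra.par g * _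
      induction g using SFun.induction with
      | hadd a b ha hb => rw [mul_add, map_add, add_mul, ha, hb]
      | hmk f w =>
        rw [SFun.par_mk, coord_inr, SFun.mk_mul_mk, SFun.mk_mul_mk, one_mul, mul_one, ι_mul_eq]

theorem superCenter_comm {p q : ℕ} {f g : SFun l n} (hf : f ∈ superCenter l n p)
    (hg : SuperAlgebra.par g = (-1 : ℝ) ^ q • g) : f * g = (-1 : ℝ) ^ (p * q) • (g * f) := by
  rw [hf.2, par_iterate_of_homog p q g hg, smul_mul_assoc]

theorem mul_mem_superCenter {p q : ℕ} {f g : SFun l n} (hf : f ∈ superCenter l n p)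
    (hg : g ∈ superCenter l n q) : f * g ∈ superCenter l n (p + q) := by
  refine ⟨?_, fun h => ?_⟩
  · rw [map_mul, hf.1, hg.1, smul_mul_smul_comm, pow_add]
  · rw [mul_assoc, hg.2, ← mul_assoc, hf.2, Function.iterate_add_apply, mul_assoc]

/-- The Leibniz rule for `f D` needs `f` to move past the first argument, hence the hypothesis that
`f` is supercentral. -/
theorem lmul_mul_mem_superDer {p q : ℕ} {f : SFun l n} {D : Module.End ℝ (SFun l n)}
    (hf : f ∈ superCenter l n p) (hD : D ∈ superDer (SFun l n) q) :
    lmul f * D ∈ superDer (SFun l n) (p + q) := by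
  refine ⟨?_, fun g h => ?_⟩
  · ext a
    rw [par_end_apply, Module.End.mul_apply, LinearMap.mulLeft_apply, map_mul, hf.1,
      superDer_par_apply hD, SuperAlgebra.par_par, smul_mul_smul_comm, pow_add]
    rfl
  · simp only [Module.End.mul_apply, LinearMap.mulLeft_apply]
    rw [hD.2, mul_add, mul_assoc, ← mul_assoc f _ (D h), hf.2 ((SuperAlgebra.par)^[q] g),
      Function.iterate_add_apply, mul_assoc ((SuperAlgebra.par)^[p] _)]

theorem superDer_mul_lmul {p q : ℕ} {D : Module.End ℝ (SFun l n)} (hD : D ∈ superDer (SFun l n) p)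
    {f : SFun l n} (hf : SuperAlgebra.par f = (-1 : ℝ) ^ q • f) :
    D * lmul f = lmul (D f) + (-1 : ℝ) ^ (p * q) • (lmul f * D) := by
  ext g
  simp only [Module.End.mul_apply, LinearMap.mulLeft_apply, LinearMap.add_apply,
    LinearMap.smul_apply]
  exact superDer_mul_of_homog hD hf g

theorem end_mul_neg (D E : Module.End ℝ (SFun l n)) : D * -E = -(D * E) := by
  ext a
  simp only [Module.End.mul_apply, LinearMap.neg_apply, map_neg]

theorem end_neg_mul (D E : Module.End ℝ (SFun l n)) : -D * E = -(D * E) := by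
  ext a
  simp only [Module.End.mul_apply, LinearMap.neg_apply]

theorem lmul_add (f g : SFun l n) : lmul (f + g) = lmul f + lmul g := by ext1; simp [add_mul]

theorem lmul_sub (f g : SFun l n) : lmul (f - g) = lmul f - lmul g := by ext1; simp [sub_mul]

theorem lmul_neg (f : SFun l n) : lmul (-f) = -lmul f := by ext1; simp

theorem lmul_smul (c : ℝ) (f : SFun l n) : lmul (c • f) = c • lmul f := by ext1; simp

theorem lmul_zero : lmul (0 : SFun l n) = 0 := by ext1; simp

theorem lmul_one : lmul (1 : SFun l n) = 1 := by ext1; simp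

theorem lmul_mul (f g : SFun l n) : lmul (f * g) = lmul f * lmul g := by ext1; simp

end VectorFields

/-! ### Homogeneous coordinates -/

section Homogeneous

variable {l n : ℕ}

theorem HIdx.cases {P : HIdx l n → Prop} (zero : P (h0 l n)) (aff : ∀ i, P (affIdx i))
    (h : HIdx l n) : P h := by
  rcases h with (i | i) | j
  · refine Fin.cases zero (fun i => aff (Sum.inl (some (Sum.inl i)))) i
  · refine Fin.cases (aff (Sum.inl none)) (fun i => aff (Sum.inl (some (Sum.inr i)))) i
  · exact aff (Sum.inr j)

theorem affIdx_injective : Function.Injective (affIdx (l := l) (n := n)) := by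
  rintro ((_ | (i | i)) | i) ((_ | (j | j)) | j) h <;>
    simp_all [affIdx, Fin.succ_ne_zero, (Fin.succ_ne_zero _).symm]

theorem affIdx_inj {i j : Idx l n} : affIdx i = affIdx j ↔ i = j := affIdx_injective.eq_iff

theorem affIdx_ne_h0 (i : Idx l n) : affIdx i ≠ h0 l n := by
  rcases i with (_ | (i | i)) | i <;> simp [affIdx, h0, Fin.succ_ne_zero]

theorem h0_ne_affIdx (i : Idx l n) : h0 l n ≠ affIdx i := (affIdx_ne_h0 i).symm

theorem parity_affIdx (i : Idx l n) : parity (affIdx i) = parity i := by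
  rcases i with (_ | (i | i)) | i <;> rfl

theorem parity_h0 : parity (h0 l n) = 0 := rfl

theorem HIdx.sum_eq {M : Type*} [AddCommMonoid M] (f : HIdx l n → M) :
    ∑ h, f h = f (h0 l n) + ∑ i, f (affIdx i) := by
  simp only [Fintype.sum_sum_type, Fin.sum_univ_succ, Fintype.sum_option, affIdx, h0]
  abel

/-- The homogeneous coordinates restricted to the affine chart where the first one is `1`. -/
def hcoord : HIdx l n → SFun l n
  | Sum.inl (Sum.inl i) =>
      Fin.cases (motive := fun _ => SFun l n) 1 (fun i => coord (Sum.inl (some (Sum.inl i)))) i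
  | Sum.inl (Sum.inr i) =>
      Fin.cases (motive := fun _ => SFun l n) (coord (Sum.inl none))
        (fun i => coord (Sum.inl (some (Sum.inr i)))) i
  | Sum.inr j => coord (Sum.inr j)

theorem hcoord_h0 : hcoord (h0 l n) = 1 := rfl

theorem hcoord_affIdx (i : Idx l n) : hcoord (affIdx i) = coord i := by
  rcases i with (_ | (i | i)) | i <;> rfl

variable (l n) in
/-- The Euler vector field. -/
def euler : Module.End ℝ (SFun l n) := ∑ i, lmul (coord i) * del i

/-- The derivatives along the homogeneous coordinates, acting on functions that are homogeneous of
degree zero. -/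
def hdel : HIdx l n → Module.End ℝ (SFun l n)
  | Sum.inl (Sum.inl i) => Fin.cases (motive := fun _ => Module.End ℝ (SFun l n)) (-euler l n)
      (fun i => del (Sum.inl (some (Sum.inl i)))) i
  | Sum.inl (Sum.inr i) => Fin.cases (motive := fun _ => Module.End ℝ (SFun l n))
      (del (Sum.inl none)) (fun i => del (Sum.inl (some (Sum.inr i)))) i
  | Sum.inr j => del (Sum.inr j)

theorem hdel_h0 : hdel (h0 l n) = -euler l n := rfl

theorem hdel_affIdx (i : Idx l n) : hdel (affIdx i) = del i := by
  rcases i with (_ | (i | i)) | i <;> rfl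

theorem hcoord_mem_superCenter (a : HIdx l n) : hcoord a ∈ superCenter l n (parity a) := by
  induction a using HIdx.cases with
  | zero => exact one_mem_superCenter
  | aff i => rw [hcoord_affIdx, parity_affIdx]; exact coord_mem_superCenter i

theorem par_hcoord (a : HIdx l n) :
    SuperAlgebra.par (hcoord a) = (-1 : ℝ) ^ parity a • hcoord a := (hcoord_mem_superCenter a).1

theorem hcoord_comm (a b : HIdx l n) :
    hcoord a * hcoord b = (-1 : ℝ) ^ (parity a * parity b) • (hcoord b * hcoord a) :=
  superCenter_comm (hcoord_mem_superCenter a) (par_hcoord b)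

theorem euler_mem_superDer : euler l n ∈ superDer (SFun l n) 0 := by
  refine sum_mem fun i _ => ?_
  rw [superDer_congr (q := parity i + parity i) (by lia)]
  exact lmul_mul_mem_superDer (coord_mem_superCenter i) (del_mem_superDer i)

theorem hdel_mem_superDer (a : HIdx l n) : hdel a ∈ superDer (SFun l n) (parity a) := by
  induction a using HIdx.cases with
  | zero => exact neg_mem euler_mem_superDer
  | aff i => rw [hdel_affIdx, parity_affIdx]; exact del_mem_superDer i

theorem euler_coord (i : Idx l n) : euler l n (coord i) = coord i := by
  simp only [euler, LinearMap.sum_apply, Module.End.mul_apply, LinearMap.mulLeft_apply, del_coord,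
    mul_ite, mul_one, mul_zero, Finset.sum_ite_eq', Finset.mem_univ, if_true]

/-- On the chart `t^b` stands for the ratio `t^b / t^0`; the second term is its derivative through
the denominator. -/
theorem hdel_hcoord (a b : HIdx l n) : hdel a (hcoord b) =
    (if a = b then 1 else 0) - (if a = h0 l n then hcoord b else 0) := by
  induction b using HIdx.cases with
  | zero =>
    rw [hcoord_h0, superDer_one (hdel_mem_superDer a)]
    split_ifs <;> simp
  | aff j =>
    induction a using HIdx.cases with
    | zero =>
      rw [hdel_h0, hcoord_affIdx, if_neg (h0_ne_affIdx j), if_pos rfl, LinearMap.neg_apply,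
        euler_coord, zero_sub]
    | aff i =>
      rw [hdel_affIdx, hcoord_affIdx, if_neg (affIdx_ne_h0 i), sub_zero, del_coord]
      simp only [affIdx_inj]

theorem hdel_mul_hcoord (a b : HIdx l n) : hdel a * lmul (hcoord b) =
    (if a = b then 1 else 0) - (if a = h0 l n then lmul (hcoord b) else 0) +
      (-1 : ℝ) ^ (parity a * parity b) • (lmul (hcoord b) * hdel a) := by
  rw [superDer_mul_lmul (hdel_mem_superDer a) (par_hcoord b), hdel_hcoord, lmul_sub]
  congr 2
  · split_ifs
    · exact lmul_one
    · exact lmul_zero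
  · split_ifs
    · rfl
    · exact lmul_zero

/-- Only the `i`-th coefficient of the Euler field is hit by `∂_i`, and this leaves `∂_i`. -/
theorem del_mul_euler (i : Idx l n) : del i * euler l n = del i + euler l n * del i := by
  have h : ∀ k : Idx l n, del i * (lmul (coord k) * del k) =
      (if i = k then del k else 0) + lmul (coord k) * del k * del i := by
    intro k
    rw [← mul_assoc, superDer_mul_lmul (del_mem_superDer i) (coord_mem_superCenter k).1, del_coord,
      add_mul, smul_mul_assoc, mul_assoc, mul_assoc, del_comm i k, mul_smul_comm, smul_smul,
      neg_one_pow_mul_self, one_smul]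
    congr 1
    split_ifs
    · rw [lmul_one, one_mul]
    · rw [lmul_zero, zero_mul]
  rw [euler, Finset.mul_sum, Finset.sum_congr rfl fun k _ => h k, Finset.sum_add_distrib,
    Finset.sum_ite_eq, if_pos (Finset.mem_univ _), Finset.sum_mul]

/-- The corrections come from `∂_0 = -E` and `[∂_i, E] = ∂_i`. -/
theorem hdel_comm (a b : HIdx l n) : hdel a * hdel b =
    (-1 : ℝ) ^ (parity a * parity b) • (hdel b * hdel a) - (if b = h0 l n then hdel a else 0) +
      (if a = h0 l n then hdel b else 0) := by
  induction a using HIdx.cases with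
  | zero =>
    induction b using HIdx.cases with
    | zero => simp [parity_h0]
    | aff j =>
      rw [hdel_h0, hdel_affIdx, parity_h0, if_neg (affIdx_ne_h0 j), if_pos rfl, end_mul_neg, end_neg_mul,
        del_mul_euler]
      simp only [zero_mul, pow_zero, one_smul]; abel
  | aff i =>
    induction b using HIdx.cases with
    | zero =>
      rw [hdel_h0, hdel_affIdx, parity_h0, if_neg (affIdx_ne_h0 i), if_pos rfl, end_mul_neg, end_neg_mul,
        del_mul_euler]
      simp only [mul_zero, pow_zero, one_smul]; abel
    | aff j =>
      rw [hdel_affIdx, hdel_affIdx, parity_affIdx, parity_affIdx, if_neg (affIdx_ne_h0 i),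
        if_neg (affIdx_ne_h0 j), del_comm, sub_zero, add_zero]

end Homogeneous

/-! ### The projective embedding -/

section Projective

variable {l n : ℕ}

/-- The vector field `t^j ∂_i` in homogeneous coordinates. -/
def hgen (i j : HIdx l n) : Module.End ℝ (SFun l n) := lmul (hcoord j) * hdel i

theorem hgen_mem_superDer (i j : HIdx l n) :
    hgen i j ∈ superDer (SFun l n) (parity i + parity j) := by
  rw [add_comm]
  exact lmul_mul_mem_superDer (hcoord_mem_superCenter j) (hdel_mem_superDer i)

/-- The sign `(-1)^(|j|(|i|+|j|))`. -/
def glSign (i j : HIdx l n) : ℝ := (-1) ^ (parity j * (parity i + parity j))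

theorem glSign_mul_self (i j : HIdx l n) : glSign i j * glSign i j = 1 := neg_one_pow_mul_self _

theorem end_sub_smul (c d : ℝ) (D : Module.End ℝ (SFun l n)) : (c - d) • D = c • D - d • D := by
  module

theorem sum_smul_euler (c : ℝ) : ∑ i : Idx l n, ∑ j : Idx l n,
    ((-1 : ℝ) ^ (parity j * (parity i + parity j)) * (c * if i = j then 1 else 0)) •
      (lmul (coord j) * del i) = c • euler l n := by
  rw [euler, Finset.smul_sum]
  refine Finset.sum_congr rfl fun i _ => ?_
  rw [Finset.sum_eq_single i]
  · rw [if_pos rfl, mul_one, ← two_mul, mul_left_comm, pow_mul]; simp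
  · intro j _ hj
    rw [if_neg hj.symm, mul_zero, mul_zero, zero_smul]
  · simp

/-- Column `0` gives the constant part because `t^0 = 1`; row `0` gives the quadratic part because
`∂_0 = -E`. The normalisation `A - A₀₀ Id` contributes `A₀₀ E`, which is the `(0,0)` term. -/
theorem projLin_apply (A : gl l n) :
    projLin l n A = -∑ i, ∑ j, (glSign i j * A i j) • hgen i j := by
  change projField _ = _
  have h1 : ∀ i j : Idx l n, (A - A (h0 l n) (h0 l n) • (1 : gl l n)) (affIdx i) (affIdx j) =
      A (affIdx i) (affIdx j) - A (h0 l n) (h0 l n) * if i = j then 1 else 0 := by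
    intro i j
    simp [Matrix.one_apply, affIdx_inj]
  have h2 : ∀ i : Idx l n, (A - A (h0 l n) (h0 l n) • (1 : gl l n)) (affIdx i) (h0 l n) =
      A (affIdx i) (h0 l n) := by
    intro i
    simp [affIdx_ne_h0 i]
  have h3 : ∀ j : Idx l n, (A - A (h0 l n) (h0 l n) • (1 : gl l n)) (h0 l n) (affIdx j) =
      A (h0 l n) (affIdx j) := by
    intro j
    simp [h0_ne_affIdx j]
  have hs : ∀ j : Idx l n, (-1 : ℝ) ^ (parity j * parity j) = (-1 : ℝ) ^ parity j := by
    intro j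
    rcases parity_eq_zero_or_one j with h | h <;> simp [h]
  have h4 : ∀ j : Idx l n, ∑ i : Idx l n, ((-1 : ℝ) ^ parity j * A (h0 l n) (affIdx j)) •
      (lmul (coord j * coord i) * del i) =
      ((-1 : ℝ) ^ parity j * A (h0 l n) (affIdx j)) • (lmul (coord j) * euler l n) := by
    intro j
    rw [euler, Finset.mul_sum, Finset.smul_sum]
    simp only [lmul_mul, mul_assoc]
  rw [projField]
  simp only [h1, h2, h3, mul_sub, end_sub_smul, Finset.sum_sub_distrib, sum_smul_euler]
  rw [Finset.sum_comm (f := fun i j => ((-1 : ℝ) ^ parity j * A (h0 l n) (affIdx j)) • _),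
    Finset.sum_congr rfl fun j _ => h4 j]
  simp only [HIdx.sum_eq, hgen, glSign, hcoord_h0, hcoord_affIdx, hdel_h0, hdel_affIdx, parity_h0,
    parity_affIdx, lmul_one, one_mul, zero_mul, zero_add, add_zero, pow_zero, end_mul_neg, smul_neg,
    Finset.sum_add_distrib, Finset.sum_neg_distrib, hs]
  abel

theorem projLin_mem_vect (A : gl l n) : projLin l n A ∈ vect l n := by
  rw [projLin_apply]
  exact neg_mem (sum_mem fun i _ => sum_mem fun j _ =>
    Submodule.smul_mem _ _ (superDer_le_vect _ (hgen_mem_superDer i j)))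

theorem projLin_par (A : gl l n) :
    projLin l n (SuperAlgebra.par A) = SuperAlgebra.par (projLin l n A) := by
  rw [projLin_apply, projLin_apply, map_neg, map_sum]
  congr 1
  refine Finset.sum_congr rfl fun i _ => ?_
  rw [map_sum]
  refine Finset.sum_congr rfl fun j _ => ?_
  rw [map_smul, (hgen_mem_superDer i j).1, smul_smul, par_gl_apply]
  congr 1; ring

theorem hgen_mul_hgen (i j k m : HIdx l n) : hgen i j * hgen k m =
    (if i = m then hgen k j else 0)
      - (if i = h0 l n then lmul (hcoord j) * lmul (hcoord m) * hdel k else 0)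
      + (-1 : ℝ) ^ (parity i * parity m) •
        (lmul (hcoord j) * lmul (hcoord m) * (hdel i * hdel k)) := by
  have h : hgen i j * hgen k m =
      lmul (hcoord j) * (hdel i * lmul (hcoord m)) * hdel k := by
    simp only [hgen, mul_assoc]
  rw [h, hdel_mul_hcoord, mul_add, mul_sub, add_mul, sub_mul, mul_smul_comm, smul_mul_assoc]
  congr 1
  · congr 1
    · split_ifs
      · rw [mul_one, hgen]
      · rw [mul_zero, zero_mul]
    · split_ifs
      · rfl
      · rw [mul_zero, zero_mul]

/-- The second-order parts cancel up to the index-`0` corrections of `hdel_comm`, and these are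
cancelled by the index-`0` corrections of `hdel_hcoord`. What remains is the bracket of matrix units
with the two terms interchanged, which explains the minus sign in `P`. -/
theorem superComm_hgen (i j k m : HIdx l n) : superComm (hgen i j) (hgen k m) =
    (if m = i then hgen k j else 0) -
      (-1 : ℝ) ^ ((parity i + parity j) * (parity k + parity m)) •
        (if j = k then hgen i m else 0) := by
  have hc : lmul (hcoord m) * lmul (hcoord j) =
      (-1 : ℝ) ^ (parity m * parity j) • (lmul (hcoord j) * lmul (hcoord m) :
        Module.End ℝ (SFun l n)) := by
    rw [← lmul_mul, hcoord_comm, lmul_smul, lmul_mul]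
  rw [superComm_homog _ _ _ _ (hgen_mem_superDer i j).1 (hgen_mem_superDer k m).1, hgen_mul_hgen,
    hgen_mul_hgen, hc, hdel_comm i k]
  simp only [eq_comm (a := i) (b := m), eq_comm (a := k) (b := j)]
  generalize lmul (hcoord j) * lmul (hcoord m) = P
  generalize (if m = i then hgen k j else 0) = Q
  generalize (if j = k then hgen i m else 0) = R
  simp only [mul_add, mul_sub, mul_smul_comm, smul_mul_assoc, mul_ite, mul_zero]
  by_cases hi : i = h0 l n <;> by_cases hk : k = h0 l n <;>
    simp only [hi, hk, if_true, if_false, parity_h0] <;>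
    rcases parity_eq_zero_or_one i with pi | pi <;> rcases parity_eq_zero_or_one j with pj | pj <;>
    rcases parity_eq_zero_or_one k with pk | pk <;> rcases parity_eq_zero_or_one m with pm | pm <;>
    simp only [pi, pj, pk, pm, mul_zero, add_zero, zero_add, mul_one, pow_zero,
      pow_one, Nat.reduceAdd, even_two.neg_one_pow] <;>
    module

theorem par_single (i j : HIdx l n) :
    SuperAlgebra.par (Matrix.single i j (1 : ℝ)) =
      (-1 : ℝ) ^ (parity i + parity j) • Matrix.single i j (1 : ℝ) := by
  ext k m
  rw [par_gl_apply, Matrix.smul_apply, smul_eq_mul]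
  by_cases h : i = k ∧ j = m
  · rw [h.1, h.2]
  · rw [Matrix.single_apply, if_neg h, mul_zero, mul_zero]

theorem superComm_single (i j k m : HIdx l n) :
    superComm (Matrix.single i j (1 : ℝ)) (Matrix.single k m (1 : ℝ)) =
      (if j = k then Matrix.single i m (1 : ℝ) else 0) -
      (-1 : ℝ) ^ ((parity i + parity j) * (parity k + parity m)) •
        (if m = i then Matrix.single k j (1 : ℝ) else 0) := by
  rw [superComm_homog _ _ _ _ (par_single i j) (par_single k m)]
  congr 2
  · split_ifs with h
    · subst h; simp
    · simp [h]
  · split_ifs with h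
    · subst h; simp
    · simp [h]

theorem projLin_single (i j : HIdx l n) :
    projLin l n (Matrix.single i j (1 : ℝ)) = (-glSign i j) • hgen i j := by
  have hn : (-glSign i j) • hgen i j = -(glSign i j • hgen i j) := by module
  rw [projLin_apply, hn, Finset.sum_eq_single i, Finset.sum_eq_single j]
  · simp
  · intro k _ hk; simp [hk.symm]
  · simp
  · intro k _ hk; simp [hk.symm]
  · simp

/-- By bilinearity it suffices to compare structure constants on matrix units; the signs are checked
for each choice of four parities. -/
theorem projLin_superComm (A B : gl l n) :
    projLin l n (superComm A B) = superComm (projLin l n A) (projLin l n B) := by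
  induction A using Matrix.induction_on' with
  | h_zero => simp
  | h_add A A' hA hA' => simp only [map_add, LinearMap.add_apply, hA, hA']
  | h_std_basis i j c =>
    induction B using Matrix.induction_on' with
    | h_zero => simp
    | h_add B B' hB hB' => simp only [map_add, hB, hB']
    | h_std_basis k m d =>
      have hc : ∀ (i j : HIdx l n) (c : ℝ), Matrix.single i j c = c • Matrix.single i j (1 : ℝ) := by
        intro i j c; simp
      rw [hc i j c, hc k m d]
      simp only [map_smul, LinearMap.smul_apply]
      rw [superComm_single, projLin_single, projLin_single,
        map_smul, map_smul, LinearMap.smul_apply, superComm_hgen, map_sub, map_smul, apply_ite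
        (projLin l n), apply_ite (projLin l n), map_zero, projLin_single, projLin_single]
      congr 2
      by_cases h1 : j = k <;> by_cases h2 : m = i
      all_goals
        simp only [h1, h2, if_true, if_false, glSign]
        rcases parity_eq_zero_or_one i with pi | pi <;>
        rcases parity_eq_zero_or_one j with pj | pj <;>
        rcases parity_eq_zero_or_one k with pk | pk <;>
        rcases parity_eq_zero_or_one m with pm | pm <;>
        simp only [pi, pj, pk, pm, mul_zero, zero_mul, add_zero, zero_add, mul_one, pow_zero,
          pow_one, Nat.reduceAdd, even_two.neg_one_pow] <;>
        module

theorem projLin_hcoord (A : gl l n) (c : HIdx l n) : projLin l n A (hcoord c) =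
    ∑ j, (glSign (h0 l n) j * A (h0 l n) j) • (hcoord j * hcoord c) -
      ∑ j, (glSign c j * A c j) • hcoord j := by
  have h : ∀ i, ∑ j, (glSign i j * A i j) • (hcoord j * hdel i (hcoord c)) =
      (if i = c then ∑ j, (glSign i j * A i j) • hcoord j else 0) -
      (if i = h0 l n then ∑ j, (glSign i j * A i j) • (hcoord j * hcoord c) else 0) := by
    intro i
    simp only [hdel_hcoord, mul_sub, smul_sub, Finset.sum_sub_distrib]
    congr 1 <;> split_ifs <;> simp
  rw [projLin_apply, LinearMap.neg_apply]
  simp only [LinearMap.sum_apply, LinearMap.smul_apply, hgen, Module.End.mul_apply,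
    LinearMap.mulLeft_apply, h, Finset.sum_sub_distrib, Finset.sum_ite_eq', Finset.mem_univ,
    if_true, neg_sub]

/-- The polynomials `P(A)(t^c)` have degree at most two, and their coefficients are the entries of
`A` up to sign; derivatives isolate them, highest degree first. -/
theorem projLin_eq_zero {A : gl l n} (hA : projLin l n A = 0) : A = A (h0 l n) (h0 l n) • 1 := by
  set a : HIdx l n → HIdx l n → ℝ := fun i j => glSign i j * A i j with ha
  have e0 : ∀ c : HIdx l n,
      ∑ j, a (h0 l n) j • (hcoord j * hcoord c) - ∑ j, a c j • hcoord j = 0 := by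
    intro c; rw [← projLin_hcoord, hA, LinearMap.zero_apply]
  have hd : ∀ (m : Idx l n) (j : HIdx l n), del m (hcoord j) = if affIdx m = j then 1 else 0 := by
    intro m j
    rw [← hdel_affIdx, hdel_hcoord, if_neg (affIdx_ne_h0 m), sub_zero]
  -- This is `∂_m` applied to `e0` at an affine index.
  have e1 : ∀ m c : Idx l n, a (h0 l n) (affIdx m) • hcoord (affIdx c) +
      (if m = c then ∑ j, ((-1 : ℝ) ^ (parity m * parity j) * a (h0 l n) j) • hcoord j else 0) -
      a (affIdx c) (affIdx m) • 1 = 0 := by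
    intro m c
    have h := congrArg (del m) (e0 (affIdx c))
    have hm : ∀ j, del m (hcoord j * hcoord (affIdx c)) =
        (if affIdx m = j then hcoord (affIdx c) else 0) +
        if m = c then (-1 : ℝ) ^ (parity m * parity j) • hcoord j else 0 := by
      intro j
      rw [superDer_mul_of_homog (del_mem_superDer m) (par_hcoord j), hd, hd]
      simp only [affIdx_inj]
      congr 1
      · split_ifs <;> simp
      · split_ifs <;> simp
    rw [map_sub, map_sum, map_sum, map_zero] at h
    simp only [map_smul, hm, hd, smul_add, Finset.sum_add_distrib, smul_ite, smul_zero,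
      Finset.sum_ite_eq, Finset.mem_univ, if_true, smul_smul] at h
    refine Eq.trans ?_ h
    congr 2
    split_ifs
    · simp only [mul_comm]
    · simp
  have ne1 : ∀ x : ℝ, x • (1 : SFun l n) = 0 → x = 0 := fun x hx =>
    (smul_eq_zero.1 hx).resolve_right one_ne_zero
  -- A second derivative of the equation for `m = c = z`. The coordinate `z` exists for all `l` and
  -- `n`, and being even it has `z² ≠ 0`: the coefficient of `z²` is doubled rather than lost.
  have e2 : ∀ p : Idx l n, a (h0 l n) (affIdx p) = 0 := by
    have key : ∀ p : Idx l n, (if p = zIdx l n then a (h0 l n) (affIdx (zIdx l n)) else 0) +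
        a (h0 l n) (affIdx p) = 0 := by
      intro p
      have h := congrArg (del p) (e1 (zIdx l n) (zIdx l n))
      have hz : parity (zIdx l n) = 0 := rfl
      rw [if_pos rfl, map_sub, map_add, map_sum, map_zero, map_smul, map_smul,
        superDer_one (del_mem_superDer p)] at h
      simp only [map_smul, hd, hz, zero_mul, pow_zero, one_mul, smul_ite, smul_zero,
        Finset.sum_ite_eq, Finset.mem_univ, if_true, sub_zero, affIdx_inj] at h
      apply ne1
      rw [← h, add_smul]
      congr 1
      split_ifs <;> simp
    have hz := key (zIdx l n)
    rw [if_pos rfl] at hz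
    intro p
    have h := key p
    split_ifs at h <;> linarith
  -- With the quadratic part gone, `e1` is an equation between constants.
  have e3 : ∀ m c : Idx l n, a (affIdx c) (affIdx m) = if m = c then a (h0 l n) (h0 l n) else 0 := by
    intro m c
    have h := e1 m c
    rw [HIdx.sum_eq] at h
    simp only [e2, mul_zero, zero_smul, Finset.sum_const_zero, parity_h0, pow_zero, one_mul,
      hcoord_h0, zero_add, add_zero] at h
    have h' : ((if m = c then a (h0 l n) (h0 l n) else 0) - a (affIdx c) (affIdx m)) •
        (1 : SFun l n) = 0 := by
      rw [← h, sub_smul]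
      congr 1
      split_ifs <;> simp
    linarith [ne1 _ h']
  have e4 : ∀ c : Idx l n, a (affIdx c) (h0 l n) = 0 := by
    intro c
    have h := e0 (affIdx c)
    rw [HIdx.sum_eq, HIdx.sum_eq] at h
    simp only [e2, e3, hcoord_h0, one_mul, zero_smul, Finset.sum_const_zero, add_zero, ite_smul,
      Finset.sum_ite_eq', Finset.mem_univ, if_true] at h
    apply ne1
    rw [sub_eq_zero] at h
    exact right_eq_add.1 h
  have g : ∀ i j, A i j = glSign i j * a i j := by
    intro i j
    rw [ha, ← mul_assoc, glSign_mul_self, one_mul]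
  have gd : ∀ i : HIdx l n, glSign i i = 1 := by
    intro i
    rw [glSign, ← two_mul, mul_left_comm, pow_mul]; simp
  ext i j
  rw [Matrix.smul_apply, Matrix.one_apply, g i j, g (h0 l n) (h0 l n), gd, one_mul]
  induction i using HIdx.cases with
  | zero =>
    induction j using HIdx.cases with
    | zero => simp [gd]
    | aff j => simp [e2, h0_ne_affIdx]
  | aff i =>
    induction j using HIdx.cases with
    | zero => simp [e4, affIdx_ne_h0]
    | aff j =>
      rw [e3]
      by_cases h : j = i
      · subst h; simp [gd]
      · simp [affIdx_inj, h, Ne.symm h]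

theorem projEmb_mk (A : gl l n) : projEmb l n ((scalars (gl l n)).mkQ A) = projLin l n A := rfl

theorem projEmb_isLieSuperHom : IsLieSuperHom (projEmb l n) where
  map_par x := by
    obtain ⟨A, rfl⟩ := (scalars (gl l n)).mkQ_surjective x
    exact projLin_par A
  map_bracket x y := by
    obtain ⟨A, rfl⟩ := (scalars (gl l n)).mkQ_surjective x
    obtain ⟨B, rfl⟩ := (scalars (gl l n)).mkQ_surjective y
    exact projLin_superComm A B

theorem projEmb_injective : Function.Injective (projEmb l n) := by
  rw [injective_iff_map_eq_zero]
  intro x hx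
  obtain ⟨A, rfl⟩ := (scalars (gl l n)).mkQ_surjective x
  rw [projEmb_mk] at hx
  rw [Submodule.mkQ_apply, Submodule.Quotient.mk_eq_zero, projLin_eq_zero hx]
  exact Submodule.smul_mem _ _ (Submodule.mem_span_singleton_self _)

theorem projVect_le_vect : projVect l n ≤ vect l n := by
  rintro _ ⟨x, rfl⟩
  obtain ⟨A, rfl⟩ := (scalars (gl l n)).mkQ_surjective x
  exact projLin_mem_vect A

end Projective

/-! ### The orthosymplectic superalgebra -/

section OrthoSymplectic

variable {l n : ℕ}

theorem G_apply_of_parity_ne {i j : HIdx l n} (h : parity i ≠ parity j) : G l n i j = 0 := by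
  rcases i with i | i <;> rcases j with j | j <;> simp_all [parity, G]

/-- `G` is antisymmetric on the even block and symmetric on the odd one. -/
theorem G_transpose_apply (i j : HIdx l n) : G l n j i = -(-1) ^ parity i * G l n i j := by
  rcases i with (i | i) | i <;> rcases j with (j | j) | j <;>
    simp [parity, G, Matrix.J, Matrix.one_apply, eq_comm] <;> split_ifs <;> simp

theorem neg_ite_smul {M : Type*} [AddCommMonoid M] [Module ℝ M] (p : Prop) [Decidable p] (x : M) :
    (-if p then (1 : ℝ) else 0) • x = if p then (-1 : ℝ) • x else 0 := by
  split_ifs <;> simp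

theorem sum_G_smul {M : Type*} [AddCommMonoid M] [Module ℝ M] (f : HIdx l n → M) (a : HIdx l n) :
    ∑ c, G l n c a • f c = Sum.elim (Sum.elim (fun i => f (Sum.inl (Sum.inr i)))
      (fun i => (-1 : ℝ) • f (Sum.inl (Sum.inl i)))) (fun j => f (Sum.inr j)) a := by
  rcases a with (i | i) | i <;>
    simp [Fintype.sum_sum_type, G, Matrix.J, Matrix.one_apply, ite_smul, neg_ite_smul]

theorem G_transpose_mul_self (l n : ℕ) : (G l n).transpose * G l n = 1 := by
  have h : (Matrix.J (Fin (l + 1)) ℝ).transpose * Matrix.J (Fin (l + 1)) ℝ = 1 := by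
    rw [Matrix.J_transpose, Matrix.neg_mul, Matrix.J_squared, neg_neg]
  rw [G, Matrix.fromBlocks_transpose, Matrix.fromBlocks_multiply, h]
  simp

theorem G_mul_transpose_self (l n : ℕ) : G l n * (G l n).transpose = 1 :=
  mul_eq_one_comm.1 (G_transpose_mul_self l n)

theorem par_G (l n : ℕ) : SuperAlgebra.par (G l n) = G l n := by
  ext i j
  rw [par_gl_apply]
  by_cases h : parity i = parity j
  · rw [h, ← two_mul, pow_mul]; simp
  · rw [G_apply_of_parity_ne h, mul_zero]

theorem par_G_transpose (l n : ℕ) :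
    SuperAlgebra.par (G l n).transpose = (G l n).transpose := by
  ext i j
  have h := congrFun (congrFun (par_G l n) j) i
  rw [par_gl_apply] at h ⊢
  rw [add_comm]; exact h

theorem homPart_apply (p : ℕ) (A : gl l n) (i j : HIdx l n) :
    homPart p A i j = (1 / 2 * (1 + (-1) ^ (p + parity i + parity j))) * A i j := by
  change (1 / 2 : ℝ) * (A i j + (-1 : ℝ) ^ p * (SuperAlgebra.par A) i j) = _
  rw [par_gl_apply, add_assoc, pow_add _ p]
  ring

theorem G_mul_homPart (p : ℕ) (A : gl l n) (i j : HIdx l n) : (G l n * homPart p A) i j =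
    (1 / 2 * (1 + (-1) ^ (p + parity i + parity j))) * (G l n * A) i j := by
  rw [Matrix.mul_apply, Matrix.mul_apply, Finset.mul_sum]
  refine Finset.sum_congr rfl fun k _ => ?_
  rw [homPart_apply]
  by_cases h : parity i = parity k
  · rw [h]; ring
  · rw [G_apply_of_parity_ne h]; ring

theorem homPart_transpose_mul_G (p : ℕ) (A : gl l n) (i j : HIdx l n) :
    ((homPart p A).transpose * G l n) i j =
      (1 / 2 * (1 + (-1) ^ (p + parity i + parity j))) * (A.transpose * G l n) i j := by
  rw [Matrix.mul_apply, Matrix.mul_apply, Finset.mul_sum]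
  refine Finset.sum_congr rfl fun k _ => ?_
  rw [Matrix.transpose_apply, Matrix.transpose_apply, homPart_apply]
  by_cases h : parity k = parity j
  · rw [h, add_right_comm]; ring
  · rw [G_apply_of_parity_ne h]; ring

theorem form_mulVec_left (A : gl l n) (U V : HIdx l n → ℝ) :
    form (A.mulVec U) V = V ⬝ᵥ (G l n * A).mulVec U := by
  rw [form, Matrix.mulVec_mulVec]

theorem form_mulVec_right (A : gl l n) (U V : HIdx l n → ℝ) :
    form U (A.mulVec V) = V ⬝ᵥ (A.transpose * G l n).mulVec U := by
  rw [form, ← Matrix.mulVec_mulVec, Matrix.dotProduct_mulVec V, Matrix.vecMul_transpose]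

/-- Tests the defining identity on basis vectors. As `G` is even, the `(i, j)` entry only sees the
homogeneous part of parity `|i| + |j|`, so all parities are captured by one matrix identity. -/
theorem mem_spo_iff_apply (A : gl l n) : A ∈ spo l n ↔ ∀ i j, (G l n * A) i j +
    (-1) ^ ((parity i + parity j) * parity j) * (A.transpose * G l n) i j = 0 := by
  change (∀ _, _) ↔ _
  constructor
  · intro h i j
    have hj : IsHomogVec (l := l) (n := n) (parity j) (Pi.single j 1) := by
      intro k
      by_cases hk : k = j
      · rw [hk]
      · simp [hk]
    have key := h (parity i + parity j) (parity j) (Pi.single j 1) (Pi.single i 1) hj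
    have he : (-1 : ℝ) ^ (parity i + parity j + parity i + parity j) = 1 := by
      rw [add_assoc, ← two_mul, pow_mul]; simp
    rw [form_mulVec_left, form_mulVec_right, Matrix.mulVec_single_one, Matrix.mulVec_single_one,
      single_one_dotProduct, single_one_dotProduct, Matrix.col_apply, Matrix.col_apply,
      G_mul_homPart, homPart_transpose_mul_G, he] at key
    linear_combination key
  · intro h p q U V hU
    rw [form_mulVec_left, form_mulVec_right, dotProduct, dotProduct, Finset.mul_sum,
      ← Finset.sum_add_distrib]
    refine Finset.sum_eq_zero fun i _ => ?_
    rw [Matrix.mulVec, Matrix.mulVec, dotProduct, dotProduct, mul_left_comm, ← mul_add,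
      Finset.mul_sum, ← Finset.sum_add_distrib, Finset.sum_eq_zero, mul_zero]
    intro j _
    rw [G_mul_homPart, homPart_transpose_mul_G]
    have h1 := h i j
    have h2 := hU j
    rcases parity_eq_zero_or_one i with hi | hi <;> rcases parity_eq_zero_or_one j with hj | hj <;>
    rcases Nat.even_or_odd p with hp | hp <;> rcases Nat.even_or_odd q with hq | hq <;>
    simp only [hi, hj, pow_add, pow_mul, hp.neg_one_pow, hq.neg_one_pow, one_pow, pow_zero, pow_one,
      mul_zero, mul_one, zero_add, Nat.reduceAdd, one_mul, even_two.neg_one_pow, neg_mul] at h1 h2 ⊢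
    -- Either the parities match and `h1` applies, or `U j` vanishes because `U` has the other
    -- parity, or the projection to parity `p` kills the entry.
    all_goals first
      | linear_combination U j * h1
      | (have h3 : U j = 0 := by linarith
         rw [h3]; ring)
      | ring

/-- The supertranspose of a matrix. -/
def superTranspose : gl l n →ₗ[ℝ] gl l n where
  toFun A := Matrix.of fun i j => (-1) ^ ((parity i + parity j) * parity j) * A j i
  map_add' A B := by ext i j; simp [mul_add]
  map_smul' c A := by ext i j; simp [mul_left_comm]

theorem superTranspose_apply (A : gl l n) (i j : HIdx l n) :
    superTranspose A i j = (-1) ^ ((parity i + parity j) * parity j) * A j i := rfl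

/-- The condition `G A + Aˢᵗ G = 0` multiplied by `Gᵗ = G⁻¹`. In this form closure under the bracket
is formal: `A ↦ -Aˢᵗ` and conjugation by the even matrix `G` both preserve brackets. -/
theorem mem_spo_iff (A : gl l n) :
    A ∈ spo l n ↔ superTranspose A = -(G l n * A * (G l n).transpose) := by
  have h : ∀ i j, (superTranspose A * G l n) i j =
      (-1) ^ ((parity i + parity j) * parity j) * (A.transpose * G l n) i j := by
    intro i j
    rw [Matrix.mul_apply, Matrix.mul_apply, Finset.mul_sum]
    refine Finset.sum_congr rfl fun k _ => ?_
    rw [superTranspose_apply, Matrix.transpose_apply]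
    by_cases h : parity k = parity j
    · rw [h]; ring
    · rw [G_apply_of_parity_ne h]; ring
  have h1 : A ∈ spo l n ↔ G l n * A + superTranspose A * G l n = 0 := by
    rw [mem_spo_iff_apply, ← Matrix.ext_iff]
    simp only [Matrix.add_apply, h, Matrix.zero_apply]
  rw [h1, add_comm]
  constructor
  · intro h2
    rw [← neg_mul, ← eq_neg_of_add_eq_zero_left h2, mul_assoc, G_mul_transpose_self, mul_one]
  · intro h2
    rw [h2, neg_mul, mul_assoc, G_transpose_mul_self, mul_one, neg_add_cancel]

theorem superTranspose_par (A : gl l n) :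
    superTranspose (SuperAlgebra.par A) = SuperAlgebra.par (superTranspose A) := by
  ext i j
  rw [superTranspose_apply, par_gl_apply, par_gl_apply, superTranspose_apply,
    add_comm (parity j) (parity i)]
  ring

theorem superTranspose_single (i j : HIdx l n) : superTranspose (Matrix.single i j (1 : ℝ)) =
    (-1 : ℝ) ^ ((parity j + parity i) * parity i) • Matrix.single j i (1 : ℝ) := by
  ext k m
  rw [superTranspose_apply, Matrix.smul_apply, smul_eq_mul, Matrix.single_apply,
    Matrix.single_apply]
  by_cases h : i = m ∧ j = k
  · rw [if_pos h, if_pos h.symm, h.1, h.2]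
  · rw [if_neg h, if_neg (fun h' => h h'.symm), mul_zero, mul_zero]

theorem superTranspose_superComm (A B : gl l n) :
    superTranspose (superComm A B) = -superComm (superTranspose A) (superTranspose B) := by
  induction A using Matrix.induction_on' with
  | h_zero => simp
  | h_add A A' hA hA' => simp only [map_add, LinearMap.add_apply, hA, hA', neg_add]
  | h_std_basis i j c =>
    induction B using Matrix.induction_on' with
    | h_zero => simp
    | h_add B B' hB hB' => simp only [map_add, hB, hB', neg_add]
    | h_std_basis k m d =>
      have hc : ∀ (i j : HIdx l n) (c : ℝ), Matrix.single i j c = c • Matrix.single i j (1 : ℝ) := by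
        intro i j c; simp
      rw [hc i j c, hc k m d]
      simp only [map_smul, LinearMap.smul_apply, ← smul_neg]
      rw [superComm_single, superTranspose_single, superTranspose_single,
        map_smul, map_smul, LinearMap.smul_apply, superComm_single, map_sub, map_smul, apply_ite
        superTranspose, apply_ite superTranspose, map_zero, superTranspose_single,
        superTranspose_single]
      congr 2
      simp only [eq_comm (a := i) (b := m), eq_comm (a := k) (b := j)]
      generalize Matrix.single m i (1 : ℝ) = P
      generalize Matrix.single j k (1 : ℝ) = Q
      by_cases h1 : j = k <;> by_cases h2 : m = i
      all_goals
        simp only [h1, h2, if_true, if_false]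
        rcases parity_eq_zero_or_one i with pi | pi <;>
        rcases parity_eq_zero_or_one j with pj | pj <;>
        rcases parity_eq_zero_or_one k with pk | pk <;>
        rcases parity_eq_zero_or_one m with pm | pm <;>
        simp only [pi, pj, pk, pm, mul_zero, zero_mul, add_zero, zero_add, mul_one, pow_zero,
          pow_one, Nat.reduceAdd, even_two.neg_one_pow] <;>
        module

theorem spo_isLieSubsuperalgebra : IsLieSubsuperalgebra (spo l n) where
  par_mem A hA := by
    rw [mem_spo_iff] at hA ⊢
    change superTranspose (SuperAlgebra.par A) = -(G l n * SuperAlgebra.par A * _)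
    rw [superTranspose_par, hA, map_neg, map_mul, map_mul, par_G, par_G_transpose]
  bracket_mem A hA B hB := by
    rw [mem_spo_iff] at hA hB ⊢
    change superTranspose (superComm A B) = -(G l n * superComm A B * _)
    have hpar : ∀ C : gl l n, SuperAlgebra.par (G l n * C * (G l n).transpose) =
        G l n * SuperAlgebra.par C * (G l n).transpose := by
      intro C
      rw [map_mul, map_mul, par_G, par_G_transpose]
    have hmul : ∀ C D : gl l n, G l n * C * (G l n).transpose * (G l n * D * (G l n).transpose) =
        G l n * (C * D) * (G l n).transpose := by
      intro C D
      rw [mul_assoc, mul_assoc (G l n) D, ← mul_assoc (G l n).transpose (G l n),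
        G_transpose_mul_self, one_mul]
      simp only [mul_assoc]
    have hneg : ∀ C D : gl l n, superComm (-C) (-D) = superComm C D := by
      intro C D
      rw [map_neg, map_neg, LinearMap.neg_apply, neg_neg]
    rw [superTranspose_superComm, hA, hB, hneg]
    congr 1
    simp only [superComm_apply, hpar, smul_mul_assoc, add_mul, sub_mul, hmul, mul_sub, mul_smul_comm,
      mul_add]

theorem one_notMem_spo : (1 : gl l n) ∉ spo l n := by
  intro h
  -- At this entry `G` equals `1`, so the condition on the identity matrix reads `1 + 1 = 0`.
  have h1 := (mem_spo_iff_apply _).1 h (Sum.inl (Sum.inr 0)) (h0 l n)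
  rw [mul_one, Matrix.transpose_one, one_mul] at h1
  simp [h0, parity, G, Matrix.J] at h1

theorem spoToPgl_injective : Function.Injective (spoToPgl l n) := by
  rw [injective_iff_map_eq_zero]
  rintro ⟨A, hA⟩ h
  change (scalars (gl l n)).mkQ A = 0 at h
  rw [Submodule.mkQ_apply, Submodule.Quotient.mk_eq_zero, Submodule.mem_span_singleton] at h
  obtain ⟨c, rfl⟩ := h
  by_cases hc : c = 0
  · simp [hc]
  · refine absurd ?_ (one_notMem_spo (l := l) (n := n))
    have := (spo l n).smul_mem c⁻¹ hA
    rwa [smul_smul, inv_mul_cancel₀ hc, one_smul] at this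

end OrthoSymplectic

/-! ### Contact fields of quadratic functions -/

section Contact

variable {l n : ℕ}

theorem parity_toIdx (r : QIdx l n) : parity (QIdx.toIdx r) = parity r := by
  rcases r with (i | i) | i <;> rfl

theorem omega_apply_of_parity_ne {r s : QIdx l n} (h : parity r ≠ parity s) :
    omega l n r s = 0 := by
  rcases r with i | i <;> rcases s with j | j <;> simp_all [parity, omega]

theorem sum_omega_smul {M : Type*} [AddCommMonoid M] [Module ℝ M] (f : QIdx l n → M)
    (r : QIdx l n) : ∑ k, omega l n k r • f k = Sum.elim (Sum.elim (fun i => (-1 : ℝ) • f (Sum.inl (Sum.inr i)))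
      (fun i => f (Sum.inl (Sum.inl i)))) (fun j => f (Sum.inr j)) r := by
  rcases r with (i | i) | i <;>
    simp [Fintype.sum_sum_type, omega, Matrix.one_apply, ite_smul, neg_ite_smul]

theorem sum_omegaInv_smul {M : Type*} [AddCommMonoid M] [Module ℝ M] (f : QIdx l n → M)
    (r : QIdx l n) : ∑ s, omegaInv l n r s • f s =
      Sum.elim (Sum.elim (fun i => (-1 : ℝ) • f (Sum.inl (Sum.inr i)))
      (fun i => f (Sum.inl (Sum.inl i)))) (fun j => f (Sum.inr j)) r := by
  rcases r with (i | i) | i <;>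
    simp [Fintype.sum_sum_type, omegaInv, Matrix.one_apply, ite_smul, neg_ite_smul]

theorem eq_zero_of_eq_neg_self {f : SFun l n} (h : f = -f) : f = 0 := by
  have h2 : (2 : ℝ) • f = 0 := by rw [two_smul]; exact add_eq_zero_iff_eq_neg.2 h
  exact (smul_eq_zero.1 h2).resolve_left two_ne_zero

theorem T_mem_superDer (r : QIdx l n) : T r ∈ superDer (SFun l n) (parity r) := by
  rw [T]
  refine sub_mem ?_ (sum_mem fun k _ => ?_)
  · rw [← parity_toIdx]; exact del_mem_superDer _
  · by_cases h : parity k = parity r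
    · have hk := lmul_mul_mem_superDer (coord_mem_superCenter (QIdx.toIdx k))
        (del_mem_superDer (zIdx l n))
      rw [parity_toIdx, h] at hk
      exact (superDer (SFun l n) (parity r)).smul_mem (omega l n k r) hk
    · rw [omega_apply_of_parity_ne h, zero_smul]
      exact zero_mem _

theorem X_apply (f : SFun l n) : X f = lmul f * del (zIdx l n) - (1 / 2 : ℝ) • ∑ r, ∑ s,
    omegaInv l n r s • (lmul (T r ((SuperAlgebra.par (A := SFun l n) ^ parity r) f)) * T s) := rfl

theorem X_of_homog {p : ℕ} {f : SFun l n} (hf : SuperAlgebra.par f = (-1 : ℝ) ^ p • f) :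
    X f = lmul f * del (zIdx l n) - (1 / 2 : ℝ) • ∑ r, (-1 : ℝ) ^ (parity r * p) •
      (lmul (T r f) * ∑ s, omegaInv l n r s • T s) := by
  rw [X_apply]
  congr 2
  refine Finset.sum_congr rfl fun r _ => ?_
  have h : (SuperAlgebra.par (A := SFun l n) ^ parity r) f = (-1 : ℝ) ^ (parity r * p) • f := by
    rcases parity_eq_zero_or_one r with hr | hr <;> rw [hr]
    · simp
    · rw [pow_one, hf, one_mul]
  rw [h, map_smul, lmul_smul, Finset.mul_sum, Finset.smul_sum]
  refine Finset.sum_congr rfl fun s _ => ?_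
  rw [smul_mul_assoc, mul_smul_comm, smul_comm]

/-- The map `f ↦ X_f - f ∂_z` obeys the Leibniz rule since each `T_r` does; the term `fg ∂_z` is
therefore counted once too often. -/
theorem X_mul {p q : ℕ} {f g : SFun l n} (hf : f ∈ superCenter l n p)
    (hg : g ∈ superCenter l n q) : X (f * g) = lmul f * X g + (-1 : ℝ) ^ (p * q) • (lmul g * X f) -
      lmul (f * g) * del (zIdx l n) := by
  rw [X_of_homog (mul_mem_superCenter hf hg).1, X_of_homog hf.1, X_of_homog hg.1]
  set Y : QIdx l n → Module.End ℝ (SFun l n) := fun r => ∑ s, omegaInv l n r s • T s with hY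
  have hT : ∀ r : QIdx l n, (-1 : ℝ) ^ (parity r * (p + q)) • (lmul (T r (f * g)) * Y r) =
      lmul f * ((-1 : ℝ) ^ (parity r * q) • (lmul (T r g) * Y r)) +
      (-1 : ℝ) ^ (p * q) • (lmul g * ((-1 : ℝ) ^ (parity r * p) • (lmul (T r f) * Y r))) := by
    intro r
    have h1 : T r f * g = (-1 : ℝ) ^ (q * (parity r + p)) • (g * T r f) := by
      rw [superCenter_comm hg (superDer_apply_homog (T_mem_superDer r) hf.1), smul_smul,
        neg_one_pow_mul_self, one_smul]
    rw [superDer_mul_of_homog (T_mem_superDer r) hf.1, h1, lmul_add, lmul_smul, lmul_smul, lmul_mul,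
      lmul_mul, add_mul, smul_add, smul_mul_assoc, smul_mul_assoc, smul_smul, smul_smul,
      mul_smul_comm, mul_smul_comm, smul_smul, mul_assoc, mul_assoc, add_comm]
    congr 2
    · rw [mul_add, pow_add, mul_right_comm, neg_one_pow_mul_self, one_mul]
    · rw [mul_add, mul_add, pow_add, pow_add, mul_comm q (parity r), mul_comm q p]
      linear_combination ((-1 : ℝ) ^ (parity r * p) * (-1) ^ (p * q)) *
        neg_one_pow_mul_self (parity r * q)
  have hz : lmul (f * g) * del (zIdx l n) = (-1 : ℝ) ^ (p * q) •
      (lmul g * (lmul f * del (zIdx l n))) := by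
    rw [superCenter_comm hf hg.1, lmul_smul, lmul_mul, smul_mul_assoc, mul_assoc]
  rw [Finset.sum_congr rfl fun r _ => hT r, Finset.sum_add_distrib, ← Finset.mul_sum,
    ← Finset.smul_sum, ← Finset.mul_sum, mul_sub, mul_sub, smul_sub, ← hz, mul_smul_comm,
    mul_smul_comm, ← mul_assoc, ← lmul_mul]
  module

/-- The derivation dual to the homogeneous coordinate `t_a` under the symplectic form. -/
def dualDel (a : HIdx l n) : Module.End ℝ (SFun l n) := ∑ c, G l n c a • hdel c

theorem X_one : X (1 : SFun l n) = del (zIdx l n) := by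
  rw [X_of_homog (p := 0) (by simp)]
  simp only [superDer_one (T_mem_superDer _), lmul_zero, zero_mul, smul_zero,
    Finset.sum_const_zero, sub_zero, lmul_one, one_mul]

theorem toIdx_injective : Function.Injective (QIdx.toIdx (l := l) (n := n)) :=
  Sum.map_injective.2 ⟨Option.some_injective _, Function.injective_id⟩

theorem zIdx_ne_toIdx (r : QIdx l n) : zIdx l n ≠ QIdx.toIdx r := by
  rcases r with (i | i) | i <;> simp [zIdx, QIdx.toIdx]

theorem T_apply_coord (r k : QIdx l n) :
    T r (coord (QIdx.toIdx k) : SFun l n) = if r = k then 1 else 0 := by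
  simp only [T, LinearMap.sub_apply, LinearMap.sum_apply, LinearMap.smul_apply,
    Module.End.mul_apply, LinearMap.mulLeft_apply, del_coord, zIdx_ne_toIdx, if_false, mul_zero,
    smul_zero, Finset.sum_const_zero, sub_zero, toIdx_injective.eq_iff]

theorem T_apply_z (r : QIdx l n) : T r (coord (zIdx l n) : SFun l n) =
    -∑ k, omega l n k r • coord (QIdx.toIdx k) := by
  simp only [T, LinearMap.sub_apply, LinearMap.sum_apply, LinearMap.smul_apply,
    Module.End.mul_apply, LinearMap.mulLeft_apply, del_coord, (zIdx_ne_toIdx _).symm, if_false,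
    if_true, mul_one, zero_sub]

theorem X_coord (k : QIdx l n) : X (coord (QIdx.toIdx k) : SFun l n) =
    lmul (coord (QIdx.toIdx k)) * del (zIdx l n) -
      ((1 / 2 : ℝ) * (-1) ^ parity k) • ∑ s, omegaInv l n k s • T s := by
  rw [X_of_homog (coord_mem_superCenter _).1, mul_smul, Finset.sum_eq_single k]
  · rw [T_apply_coord, if_pos rfl, lmul_one, one_mul, parity_toIdx]
    rcases parity_eq_zero_or_one k with h | h <;> simp only [h, mul_zero, mul_one]
  · intro r _ hr
    rw [T_apply_coord, if_neg hr, lmul_zero, zero_mul, smul_zero]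
  · simp

/-- `G` is superantisymmetric while the `t^a` supercommute, so the sum equals its own negative. It
expresses that `α` vanishes on the Euler field of the homogeneous coordinates. -/
theorem sum_G_smul_hcoord (l n : ℕ) :
    ∑ e, ∑ c, G l n e c • (hcoord e * hcoord c : SFun l n) = 0 := by
  have h : ∑ e, ∑ c, G l n e c • (hcoord e * hcoord c : SFun l n) =
      -∑ e, ∑ c, G l n e c • (hcoord e * hcoord c : SFun l n) := by
    conv_lhs => rw [Finset.sum_comm]
    rw [← Finset.sum_neg_distrib]
    refine Finset.sum_congr rfl fun e _ => ?_
    rw [← Finset.sum_neg_distrib]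
    refine Finset.sum_congr rfl fun c _ => ?_
    by_cases hp : parity e = parity c
    · rw [G_transpose_apply e c, hcoord_comm c e, hp]
      rcases parity_eq_zero_or_one c with h | h <;> simp [h]
    · rw [G_apply_of_parity_ne hp, G_apply_of_parity_ne (Ne.symm hp)]; simp
  exact eq_zero_of_eq_neg_self h

/-- The sum over `r, s` reduces to `∑ q^s ∂_{q^s}`: the `∂_z` parts of the `T_s` drop out because
`x_i y_i = y_i x_i` and `θ_j² = 0`. -/
theorem X_z : (2 : ℝ) • X (coord (zIdx l n) : SFun l n) =
    lmul (coord (zIdx l n)) * del (zIdx l n) + euler l n := by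
  have hxy : ∀ i : Fin l, (coord (Sum.inl (some (Sum.inl i))) : SFun l n) *
      coord (Sum.inl (some (Sum.inr i))) =
      coord (Sum.inl (some (Sum.inr i))) * coord (Sum.inl (some (Sum.inl i))) := by
    intro i
    have := superCenter_comm (coord_mem_superCenter (n := n) (Sum.inl (some (Sum.inl i))))
      (coord_mem_superCenter (Sum.inl (some (Sum.inr i)))).1
    simpa [parity] using this
  have hθ : ∀ j : Fin n, (coord (Sum.inr j) : SFun l n) * coord (Sum.inr j) = 0 := by
    intro j
    have := superCenter_comm (coord_mem_superCenter (l := l) (Sum.inr j))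
      (coord_mem_superCenter (Sum.inr j)).1
    simp only [parity, Sum.elim_inr, mul_one, pow_one, neg_smul, one_smul] at this
    exact eq_zero_of_eq_neg_self this
  rw [X_of_homog (coord_mem_superCenter _).1, euler]
  have hz : parity (zIdx l n) = 0 := rfl
  simp only [T_apply_z, sum_omegaInv_smul, hz, mul_zero, pow_zero, one_smul, sum_omega_smul]
  simp only [Fintype.sum_sum_type, Fintype.sum_option, Sum.elim_inl, Sum.elim_inr]
  simp only [T, sum_omega_smul, Sum.elim_inl, Sum.elim_inr, QIdx.toIdx, Sum.map_inl,
    Sum.map_inr, id, neg_smul, one_smul, lmul_neg, end_neg_mul, end_mul_neg, mul_sub, ← mul_assoc, ← lmul_mul, hxy, hθ,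
    lmul_zero, zero_mul, neg_neg, Finset.sum_sub_distrib, Finset.sum_neg_distrib]
  simp only [zIdx, Finset.sum_const_zero]
  module

/-- A uniform formula for `X` on constants and coordinates: for `t^0 = 1` the dual derivation is
`∂_z`, for `z` it is `-∂_0 = E`. -/
theorem two_smul_X_hcoord (a : HIdx l n) :
    (2 : ℝ) • X (hcoord a) = lmul (hcoord a) * del (zIdx l n) + dualDel a := by
  induction a using HIdx.cases with
  | zero =>
    rw [hcoord_h0, X_one, lmul_one, one_mul, dualDel, sum_G_smul]
    exact two_smul ℝ _
  | aff i =>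
    rw [hcoord_affIdx]
    rcases i with (_ | i) | j
    · refine X_z.trans ?_
      rw [dualDel, sum_G_smul]
      congr 1
      change _ = (-1 : ℝ) • -euler l n
      module
    · have h := X_coord (Sum.inl i : QIdx l n)
      have hc : QIdx.toIdx (Sum.inl i : QIdx l n) = Sum.inl (some i) := rfl
      rw [hc] at h
      rw [h, dualDel, sum_G_smul, sum_omegaInv_smul]
      rcases i with i | i
      all_goals
        simp only [T, sum_omega_smul, parity, Sum.elim_inl, Sum.elim_inr, affIdx, QIdx.toIdx,
          Sum.map_inl, hdel, Fin.cases_succ, pow_zero, mul_one]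
        module
    · have h := X_coord (Sum.inr j : QIdx l n)
      have hc : QIdx.toIdx (Sum.inr j : QIdx l n) = Sum.inr j := rfl
      rw [hc] at h
      rw [h, dualDel, sum_G_smul, sum_omegaInv_smul]
      simp only [T, sum_omega_smul, parity, Sum.elim_inr, affIdx, QIdx.toIdx,
          Sum.map_inr, id, hdel, pow_one]
      module

/-- The contact field of a quadratic monomial. -/
theorem X_hcoord_mul (a b : HIdx l n) : X (hcoord a * hcoord b) = (1 / 2 : ℝ) •
    (lmul (hcoord a) * dualDel b +
      (-1 : ℝ) ^ (parity a * parity b) • (lmul (hcoord b) * dualDel a)) := by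
  have h : ∀ c : HIdx l n, X (hcoord c) =
      (1 / 2 : ℝ) • (lmul (hcoord c) * del (zIdx l n) + dualDel c) := by
    intro c
    rw [← two_smul_X_hcoord, smul_smul]; norm_num
  have hz : lmul (hcoord a * hcoord b) * del (zIdx l n) = (-1 : ℝ) ^ (parity a * parity b) •
      (lmul (hcoord b) * (lmul (hcoord a) * del (zIdx l n))) := by
    rw [hcoord_comm a b, lmul_smul, lmul_mul, smul_mul_assoc, mul_assoc]
  -- The term subtracted in `X_mul` cancels the two halves of `t^a t^b ∂_z` coming from `h`.
  rw [X_mul (hcoord_mem_superCenter a) (hcoord_mem_superCenter b), h, h, mul_smul_comm,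
    mul_smul_comm, mul_add, mul_add, smul_add, smul_add, ← mul_assoc (lmul (hcoord a)),
    ← lmul_mul, hz]
  module

end Contact

/-! ### Matching `spo` with the fields of quadratic functions -/

section Isomorphism

variable {l n : ℕ}

theorem degLETwo_eq_span (l n : ℕ) : degLETwo l n = Submodule.span ℝ
    (Set.range fun ab : HIdx l n × HIdx l n => (hcoord ab.1 * hcoord ab.2 : SFun l n)) := by
  apply le_antisymm <;> rw [degLETwo, Submodule.span_le]
  · rintro _ ((rfl | ⟨i, rfl⟩) | ⟨⟨i, j⟩, rfl⟩)
    · exact Submodule.subset_span ⟨(h0 l n, h0 l n), by simp [hcoord_h0]⟩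
    · exact Submodule.subset_span ⟨(h0 l n, affIdx i), by simp [hcoord_h0, hcoord_affIdx]⟩
    · exact Submodule.subset_span ⟨(affIdx i, affIdx j), by simp [hcoord_affIdx]⟩
  · rintro _ ⟨⟨a, b⟩, rfl⟩
    apply Submodule.subset_span
    induction a using HIdx.cases with
    | zero =>
      induction b using HIdx.cases with
      | zero => exact Or.inl (Or.inl (by simp [hcoord_h0]))
      | aff j => exact Or.inl (Or.inr ⟨j, by simp [hcoord_h0, hcoord_affIdx]⟩)
    | aff i =>
      induction b using HIdx.cases with
      | zero => exact Or.inl (Or.inr ⟨i, by simp [hcoord_h0, hcoord_affIdx]⟩)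
      | aff j => exact Or.inr ⟨(i, j), by simp [hcoord_affIdx]⟩

/-- The factor `G` is absorbed into the derivations; the signs survive because `G` is even. -/
theorem projLin_G_mul (N : gl l n) : projLin l n (G l n * N) =
    -∑ a, ∑ b, (glSign b a * N b a) • (lmul (hcoord a) * dualDel b) := by
  have h : ∀ i a : HIdx l n, (glSign i a * (G l n * N) i a) • hgen i a =
      ∑ b, (glSign b a * N b a) • (lmul (hcoord a) * (G l n i b • hdel i)) := by
    intro i a
    rw [Matrix.mul_apply, Finset.mul_sum, Finset.sum_smul]
    refine Finset.sum_congr rfl fun b _ => ?_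
    rw [mul_smul_comm, smul_smul, hgen]
    by_cases hp : parity i = parity b
    · rw [glSign, glSign, hp]; congr 1; ring
    · rw [G_apply_of_parity_ne hp, zero_mul, mul_zero, mul_zero]
  rw [projLin_apply]
  simp only [h, dualDel, Finset.mul_sum, Finset.smul_sum]
  rw [Finset.sum_comm]
  congr 1
  refine Finset.sum_congr rfl fun a _ => ?_
  rw [Finset.sum_comm]

/-- The signed entries of `N` are then the coefficients of a quadratic form in supercommuting
variables. -/
theorem G_mul_mem_spo_iff (N : gl l n) : G l n * N ∈ spo l n ↔ ∀ a b : HIdx l n,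
    glSign b a * N b a = (-1) ^ (parity a * parity b) * (glSign a b * N a b) := by
  have h1 : ∀ i j, (G l n * (G l n * N)) i j = -(-1) ^ parity i * N i j := by
    intro i j
    have hN : N i j = ((G l n).transpose * (G l n * N)) i j := by
      rw [← mul_assoc, G_transpose_mul_self, one_mul]
    rw [hN, Matrix.mul_apply, Matrix.mul_apply, Finset.mul_sum]
    refine Finset.sum_congr rfl fun k _ => ?_
    rw [Matrix.transpose_apply, G_transpose_apply i k]
    linear_combination (-(G l n i k) * (G l n * N) k j) * neg_one_pow_mul_self (parity i)
  have h2 : ∀ i j, ((G l n * N).transpose * G l n) i j = N j i := by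
    intro i j
    rw [Matrix.transpose_mul, mul_assoc, G_transpose_mul_self, mul_one, Matrix.transpose_apply]
  rw [mem_spo_iff_apply]
  refine forall_congr' fun a => forall_congr' fun b => ?_
  rw [h1, h2, glSign, glSign]
  rcases parity_eq_zero_or_one a with ha | ha <;> rcases parity_eq_zero_or_one b with hb | hb <;>
    norm_num [ha, hb] <;> constructor <;> intro h <;> linarith

theorem X_sum_hcoord (c : HIdx l n → HIdx l n → ℝ) :
    X (∑ a, ∑ b, c a b • (hcoord a * hcoord b : SFun l n)) =
      ∑ a, ∑ b, ((1 / 2 : ℝ) * (c a b + (-1) ^ (parity a * parity b) * c b a)) •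
        (lmul (hcoord a) * dualDel b) := by
  have h : ∀ a b : HIdx l n, c a b • X (hcoord a * hcoord b : SFun l n) =
      ((1 / 2 : ℝ) * c a b) • (lmul (hcoord a) * dualDel b) +
      ((1 / 2 : ℝ) * ((-1) ^ (parity b * parity a) * c a b)) •
        (lmul (hcoord b) * dualDel a) := by
    intro a b
    rw [X_hcoord_mul, mul_comm (parity b)]
    module
  simp only [map_sum, map_smul, h, mul_add, add_smul, Finset.sum_add_distrib]
  congr 1
  rw [Finset.sum_comm]

theorem map_projLin_spo : (spo l n).map (projLin l n) = quadContact l n := by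
  apply le_antisymm
  · rintro _ ⟨A, hA, rfl⟩
    obtain ⟨N, rfl⟩ : ∃ N, A = G l n * N :=
      ⟨(G l n).transpose * A, by rw [← mul_assoc, G_mul_transpose_self, one_mul]⟩
    have hN := (G_mul_mem_spo_iff N).1 hA
    -- The coefficients are read from `projLin_G_mul`; being supersymmetric by `hN`, they are
    -- unchanged by the symmetrisation in `X_sum_hcoord`.
    refine ⟨-∑ a, ∑ b, (glSign b a * N b a) • (hcoord a * hcoord b), ?_, ?_⟩
    · refine neg_mem (sum_mem fun a _ => sum_mem fun b _ => ?_)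
      rw [degLETwo_eq_span]
      exact Submodule.smul_mem _ _ (Submodule.subset_span ⟨(a, b), rfl⟩)
    · rw [map_neg, X_sum_hcoord, projLin_G_mul]
      have hh : ∀ x : ℝ, 1 / 2 * (2 * x) = x := fun x => by ring
      simp only [← hN, ← two_mul, hh]
  · rintro _ ⟨f, hf, rfl⟩
    rw [SetLike.mem_coe, degLETwo_eq_span, Submodule.mem_span_range_iff_exists_fun] at hf
    obtain ⟨c, rfl⟩ := hf
    rw [Fintype.sum_prod_type]
    -- Supersymmetrised coefficients of `f`, with the minus sign and `glSign` of `projLin_G_mul`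
    -- undone.
    set N : gl l n := Matrix.of fun b a => -(glSign b a * ((1 / 2 : ℝ) *
      (c (a, b) + (-1) ^ (parity a * parity b) * c (b, a)))) with hN
    have hk : ∀ a b, glSign b a * N b a = -((1 / 2 : ℝ) *
        (c (a, b) + (-1) ^ (parity a * parity b) * c (b, a))) := by
      intro a b
      rw [hN, Matrix.of_apply, mul_neg, ← mul_assoc, glSign_mul_self, one_mul]
    refine ⟨G l n * N, (G_mul_mem_spo_iff N).2 fun a b => ?_, ?_⟩
    · rw [hk, hk, mul_comm (parity b)]
      linear_combination (1 / 2 * c (a, b)) * neg_one_pow_mul_self (parity a * parity b)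
    · rw [projLin_G_mul, X_sum_hcoord fun a b => c (a, b)]
      simp only [hk]
      have hs : ∀ (x : ℝ) (D : Module.End ℝ (SFun l n)), (-x) • D = -(x • D) := by
        intro x D; module
      simp only [hs, Finset.sum_neg_distrib]
      exact neg_neg _

/-- Transported along `P` from `spo`, so no bracket of contact fields is computed. -/
theorem quadContact_isLieSubsuperalgebra : IsLieSubsuperalgebra (quadContact l n) where
  par_mem := by
    rw [← map_projLin_spo]
    rintro _ ⟨A, hA, rfl⟩
    exact ⟨_, spo_isLieSubsuperalgebra.par_mem A hA, projLin_par A⟩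
  bracket_mem := by
    rw [← map_projLin_spo]
    rintro _ ⟨A, hA, rfl⟩ _ ⟨B, hB, rfl⟩
    exact ⟨_, spo_isLieSubsuperalgebra.bracket_mem A hA B hB, projLin_superComm A B⟩

theorem range_projEmb_comp_spoToPgl :
    LinearMap.range (projEmb l n ∘ₗ spoToPgl l n) = quadContact l n := by
  have h : projEmb l n ∘ₗ spoToPgl l n = projLin l n ∘ₗ (spo l n).subtype := rfl
  rw [h, LinearMap.range_comp, Submodule.range_subtype, map_projLin_spo]

variable (l n) in
/-- The isomorphism from `spo(2l+2|n)` onto the contact fields of quadratic functions. -/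
def spoEquiv : spo l n ≃ₗ[ℝ] quadContact l n :=
  (LinearEquiv.ofInjective (projEmb l n ∘ₗ spoToPgl l n)
    (projEmb_injective.comp spoToPgl_injective)).trans
    (LinearEquiv.ofEq _ _ range_projEmb_comp_spoToPgl)

theorem spoEquiv_isLieSuperIso : IsLieSuperIso (spoEquiv l n) where
  source := spo_isLieSubsuperalgebra
  target := quadContact_isLieSubsuperalgebra
  map_par A := projLin_par (A : gl l n)
  map_bracket A B := projLin_superComm (A : gl l n) B

end Isomorphism

/-! ### The fields of quadratic functions are contact -/

section ContactFields

variable {l n : ℕ}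

theorem sum_G_smul_right {M : Type*} [AddCommMonoid M] [Module ℝ M] (f : HIdx l n → M)
    (a : HIdx l n) : ∑ c, G l n a c • f c = Sum.elim (Sum.elim
      (fun i => (-1 : ℝ) • f (Sum.inl (Sum.inr i)))
      (fun i => f (Sum.inl (Sum.inl i)))) (fun j => f (Sum.inr j)) a := by
  rcases a with (i | i) | i <;>
    simp [Fintype.sum_sum_type, G, Matrix.J, Matrix.one_apply, ite_smul, neg_ite_smul]

/-- The components of the contact form in homogeneous coordinates. -/
def hform (e : HIdx l n) : SFun l n := ∑ c, G l n e c • hcoord c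

theorem par_hform (e : HIdx l n) :
    SuperAlgebra.par (hform e) = (-1 : ℝ) ^ parity e • hform e := by
  rw [hform, map_sum, Finset.smul_sum]
  refine Finset.sum_congr rfl fun c _ => ?_
  rw [map_smul, par_hcoord]
  by_cases h : parity e = parity c
  · rw [h, smul_comm]
  · rw [G_apply_of_parity_ne h, zero_smul, zero_smul, smul_zero]

theorem contactForm_eq_hform (i : Idx l n) : (contactForm i : SFun l n) = hform (affIdx i) := by
  rw [hform, sum_G_smul_right]
  rcases i with (_ | (i | i)) | j
  · rfl
  all_goals
    rw [contactForm, sum_omega_smul]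
    rfl

/-- The extra component `hform (h0 l n)` does not contribute, as it multiplies `Y 1`. The signs of
the pairing cancel because `α_i` has parity `|i|`. -/
theorem pairing_contactForm {Y : Module.End ℝ (SFun l n)} (hY : Y 1 = 0) :
    pairing contactForm Y = ∑ e, Y (hcoord e) * hform e := by
  rw [HIdx.sum_eq, hcoord_h0, hY, zero_mul, zero_add]
  change ∑ i : Idx l n, (-1 : ℝ) ^ (parity i * parity i) • (Y (coord i) *
    (SuperAlgebra.par (A := SFun l n))^[parity i] (contactForm i)) = _
  refine Finset.sum_congr rfl fun i _ => ?_
  rw [contactForm_eq_hform, hcoord_affIdx, par_iterate_of_homog _ _ _ (par_hform (affIdx i)),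
    parity_affIdx, mul_smul_comm, smul_smul, neg_one_pow_mul_self, one_smul]

theorem dualDel_mem_superDer (a : HIdx l n) : dualDel a ∈ superDer (SFun l n) (parity a) := by
  refine sum_mem fun c _ => ?_
  by_cases h : parity c = parity a
  · exact (superDer (SFun l n) (parity a)).smul_mem (G l n c a) (h ▸ hdel_mem_superDer c)
  · rw [G_apply_of_parity_ne h, zero_smul]
    exact zero_mem _

theorem X_hcoord_mul_mem_superDer (a b : HIdx l n) :
    X (hcoord a * hcoord b) ∈ superDer (SFun l n) (parity a + parity b) := by
  rw [X_hcoord_mul]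
  have h1 := lmul_mul_mem_superDer (hcoord_mem_superCenter a) (dualDel_mem_superDer b)
  have h2 := lmul_mul_mem_superDer (hcoord_mem_superCenter b) (dualDel_mem_superDer a)
  rw [add_comm] at h2
  exact Submodule.smul_mem _ _ (add_mem h1 (Submodule.smul_mem _ _ h2))

theorem dualDel_hcoord (b c : HIdx l n) : dualDel b (hcoord c) =
    G l n c b • (1 : SFun l n) - G l n (h0 l n) b • hcoord c := by
  simp only [dualDel, LinearMap.sum_apply, LinearMap.smul_apply, hdel_hcoord, smul_sub, smul_ite,
    smul_zero, Finset.sum_sub_distrib, Finset.sum_ite_eq', Finset.mem_univ, if_true]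

/-- The conformal factor of the contact field of a quadratic monomial. -/
def conformalFactor (a b : HIdx l n) : SFun l n := (1 / 2 : ℝ) •
  (G l n (h0 l n) b • hcoord a +
    (-1 : ℝ) ^ (parity a * parity b) • G l n (h0 l n) a • hcoord b)

/-- The entry `G_0b` vanishes for odd `b`, so each surviving term has the stated parity. -/
theorem conformalFactor_mem_superCenter (a b : HIdx l n) :
    conformalFactor a b ∈ superCenter l n (parity a + parity b) := by
  have h : ∀ a b : HIdx l n,
      G l n (h0 l n) b • hcoord a ∈ superCenter l n (parity a + parity b) := by
    intro a b
    by_cases hb : parity b = 0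
    · rw [hb, add_zero]
      exact Submodule.smul_mem _ _ (hcoord_mem_superCenter a)
    · rw [G_apply_of_parity_ne (fun h => hb (h.symm.trans parity_h0)), zero_smul]
      exact zero_mem _
  refine Submodule.smul_mem _ _ (add_mem (h a b) (Submodule.smul_mem _ _ ?_))
  rw [add_comm]
  exact h b a

theorem X_hcoord_mul_apply (a b c : HIdx l n) : X (hcoord a * hcoord b) (hcoord c) =
    (1 / 2 : ℝ) • (G l n c b • hcoord a +
      (-1 : ℝ) ^ (parity a * parity b) • G l n c a • hcoord b) -
      conformalFactor a b * hcoord c := by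
  rw [X_hcoord_mul, conformalFactor]
  simp only [LinearMap.smul_apply, LinearMap.add_apply, Module.End.mul_apply,
    LinearMap.mulLeft_apply, dualDel_hcoord, mul_sub, mul_smul_comm, mul_one, smul_mul_assoc,
    add_mul]
  module

theorem sum_G_mul_G (e b : HIdx l n) :
    ∑ c, G l n e c * G l n c b = if e = b then -(-1) ^ parity e else 0 := by
  have h : ∀ c, G l n e c * G l n c b =
      -(-1) ^ parity e * ((G l n).transpose e c * G l n c b) := by
    intro c
    rw [Matrix.transpose_apply, G_transpose_apply e c]
    linear_combination (-(G l n e c) * G l n c b) * neg_one_pow_mul_self (parity e)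
  simp only [h]
  rw [← Finset.mul_sum, ← Matrix.mul_apply, G_transpose_mul_self, Matrix.one_apply]
  simp

/-- Contract `X_hcoord_mul_apply` with the constant matrix `G`; the products `G G` collapse by
`sum_G_mul_G`. -/
theorem X_hcoord_mul_hform (a b e : HIdx l n) : X (hcoord a * hcoord b) (hform e) =
    (1 / 2 : ℝ) • ((if e = b then -(-1 : ℝ) ^ parity e else 0) • hcoord a +
      (-1 : ℝ) ^ (parity a * parity b) • (if e = a then -(-1 : ℝ) ^ parity e else 0) • hcoord b) -
      conformalFactor a b * hform e := by
  rw [← sum_G_mul_G, ← sum_G_mul_G]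
  simp only [hform, map_sum, map_smul, X_hcoord_mul_apply, smul_sub, Finset.sum_sub_distrib,
    Finset.mul_sum, mul_smul_comm, Finset.sum_smul, Finset.smul_sum, smul_add,
    Finset.sum_add_distrib, smul_smul]
  congr 2 <;> refine Finset.sum_congr rfl fun c _ => ?_ <;> congr 1 <;> ring

theorem sum_G_smul_hform (b : HIdx l n) : ∑ e, G l n e b • hform e = (hcoord b : SFun l n) := by
  have h : ∀ c, ∑ e, G l n e b * G l n e c = if b = c then 1 else 0 := by
    intro c
    rw [← Matrix.one_apply, ← G_transpose_mul_self, Matrix.mul_apply]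
    rfl
  simp only [hform, Finset.smul_sum, smul_smul]
  rw [Finset.sum_comm]
  simp only [← Finset.sum_smul, h, ite_smul, one_smul, zero_smul, Finset.sum_ite_eq,
    Finset.mem_univ, if_true]

/-- Both halves of the supercommutator pair with `α` to the same expression in `Y(t^a)` and
`Y(t^b)`, up to the sign of the supercommutator, so they cancel. -/
theorem pairing_superComm_eq_zero (a b : HIdx l n) {q : ℕ} {Y : Module.End ℝ (SFun l n)}
    (hY : Y ∈ superDer (SFun l n) q) (h : pairing contactForm Y = 0) :
    pairing contactForm (superComm (X (hcoord a * hcoord b)) Y) = 0 := by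
  have hX := X_hcoord_mul_mem_superDer a b
  have hlam := conformalFactor_mem_superCenter a b
  have hYe : ∀ e, SuperAlgebra.par (Y (hcoord e)) = (-1 : ℝ) ^ (q + parity e) • Y (hcoord e) :=
    fun e => superDer_apply_homog hY (par_hcoord e)
  rw [pairing_contactForm (superDer_one hY)] at h
  rw [pairing_contactForm (superDer_one (superComm_mem_superDer hX hY)),
    superComm_homog _ _ _ _ hX.1 hY.1]
  -- By Leibniz the derivative can be moved onto `hform e`: the total term is `X` of `α(Y) = 0`, and
  -- the `λ` term is again a multiple of `α(Y)`.
  have e1 : ∑ e, X (hcoord a * hcoord b) (Y (hcoord e)) * hform e =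
      ((-1 : ℝ) ^ ((parity a + parity b) * q) * (1 / 2)) •
        (Y (hcoord a) * hcoord b + (-1 : ℝ) ^ (parity a * parity b) •
          (Y (hcoord b) * hcoord a)) := by
    have h1 : ∀ e, X (hcoord a * hcoord b) (Y (hcoord e)) * hform e =
        X (hcoord a * hcoord b) (Y (hcoord e) * hform e) +
        conformalFactor a b * (Y (hcoord e) * hform e) -
        (1 / 2 : ℝ) • (-1 : ℝ) ^ ((parity a + parity b) * (q + parity e)) •
          ((if e = b then -(-1 : ℝ) ^ parity e else 0) • (Y (hcoord e) * hcoord a) +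
          (-1 : ℝ) ^ (parity a * parity b) • (if e = a then -(-1 : ℝ) ^ parity e else 0) •
            (Y (hcoord e) * hcoord b)) := by
      intro e
      rw [superDer_mul_of_homog hX (hYe e), X_hcoord_mul_hform, mul_sub, smul_sub,
        ← mul_assoc (Y (hcoord e)), ← mul_assoc (conformalFactor a b), superCenter_comm hlam (hYe e),
        smul_mul_assoc, mul_smul_comm, mul_add (Y (hcoord e)), mul_smul_comm, mul_smul_comm,
        mul_smul_comm]
      module
    simp only [h1, Finset.sum_sub_distrib, Finset.sum_add_distrib, ← map_sum, ← Finset.mul_sum, h,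
      map_zero, mul_zero, add_zero, zero_sub, smul_add, ite_smul, zero_smul, smul_ite, smul_zero,
      Finset.sum_ite_eq', Finset.mem_univ, if_true]
    rcases parity_eq_zero_or_one a with pa | pa <;> rcases parity_eq_zero_or_one b with pb | pb <;>
      simp only [pa, pb, mul_zero, add_zero, zero_add, mul_one, pow_zero, zero_mul, one_mul,
        pow_one, Nat.reduceAdd, pow_add, pow_mul, even_two.neg_one_pow, one_pow] <;>
      module
  -- The linear part is evaluated by `sum_G_smul_hform`. In the `λ` part, `Y(λ)` multiplies `∑ t^e
  -- α_e = 0` and `λ` multiplies `α(Y) = 0`.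
  have e2 : ∑ e, Y (X (hcoord a * hcoord b) (hcoord e)) * hform e = (1 / 2 : ℝ) •
      (Y (hcoord a) * hcoord b + (-1 : ℝ) ^ (parity a * parity b) •
        (Y (hcoord b) * hcoord a)) := by
    have h1 : ∀ e, Y (X (hcoord a * hcoord b) (hcoord e)) * hform e =
        (1 / 2 : ℝ) • (Y (hcoord a) * (G l n e b • hform e) + (-1 : ℝ) ^ (parity a * parity b) •
          (Y (hcoord b) * (G l n e a • hform e))) -
        Y (conformalFactor a b) * (hcoord e * hform e) -
        (-1 : ℝ) ^ (q * (parity a + parity b)) •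
          (conformalFactor a b * (Y (hcoord e) * hform e)) := by
      intro e
      rw [X_hcoord_mul_apply, map_sub, superDer_mul_of_homog hY hlam.1]
      simp only [map_smul, map_add, sub_mul, add_mul, smul_mul_assoc, mul_smul_comm, mul_assoc]
      module
    have h2 : ∑ e, hcoord e * hform e = (0 : SFun l n) := by
      rw [← sum_G_smul_hcoord l n]
      simp only [hform, Finset.mul_sum, mul_smul_comm]
    simp only [h1, Finset.sum_sub_distrib, Finset.sum_add_distrib, ← Finset.smul_sum,
      ← Finset.mul_sum, h, h2, sum_G_smul_hform, mul_zero, smul_zero, sub_zero]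
  simp only [LinearMap.sub_apply, LinearMap.smul_apply, Module.End.mul_apply, sub_mul,
    smul_mul_assoc, Finset.sum_sub_distrib, ← Finset.smul_sum, e1, e2]
  module

theorem par_pairing {q : ℕ} {Y : Module.End ℝ (SFun l n)} (hY : Y ∈ superDer (SFun l n) q) :
    SuperAlgebra.par (pairing contactForm Y) = (-1 : ℝ) ^ q • pairing contactForm Y := by
  rw [pairing_contactForm (superDer_one hY), map_sum, Finset.smul_sum]
  refine Finset.sum_congr rfl fun e _ => ?_
  rw [map_mul, par_hform, superDer_apply_homog hY (par_hcoord e), smul_mul_smul_comm, pow_add,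
    mul_assoc, neg_one_pow_mul_self, mul_one]

theorem quadContact_le_contactVect : quadContact l n ≤ contactVect l n := by
  rw [quadContact, Submodule.map_le_iff_le_comap, degLETwo_eq_span, Submodule.span_le]
  rintro _ ⟨⟨a, b⟩, rfl⟩
  have hX : X (hcoord a * hcoord b) ∈ vect l n :=
    superDer_le_vect _ (X_hcoord_mul_mem_superDer a b)
  refine ⟨hX, ?_⟩
  rintro Y ⟨hY, hker⟩
  refine ⟨bracket_mem_vect hX hY, ?_⟩
  obtain ⟨Y0, hY0, Y1, hY1, rfl⟩ := Submodule.mem_sup.1 hY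
  rw [SetLike.mem_coe, LinearMap.mem_ker, map_add] at hker
  have h0 := par_pairing hY0
  have h1 := par_pairing hY1
  have hp := congrArg SuperAlgebra.par hker
  rw [map_add, h0, h1, map_zero, pow_zero, one_smul, pow_one, neg_smul, one_smul] at hp
  -- As `α` is even, the parity involution fixes the pairing with `Y0` and negates that with `Y1`;
  -- hence the homogeneous parts of a tangent field are tangent.
  have hk1 : pairing contactForm Y1 = 0 := by
    refine eq_zero_of_eq_neg_self ?_
    exact (eq_neg_of_add_eq_zero_right hker).trans (congrArg _ (add_neg_eq_zero.1 hp))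
  have hk0 : pairing contactForm Y0 = 0 := by rwa [hk1, add_zero] at hker
  change pairing contactForm (superComm _ (Y0 + Y1)) = 0
  rw [map_add, map_add, pairing_superComm_eq_zero a b hY0 hk0,
    pairing_superComm_eq_zero a b hY1 hk1, add_zero]

end ContactFields

end SuperContact

end

/-! ### The theorem -/

theorem mainTheorem4 (l n : ℕ) :
    -- the projective embedding is an embedding of Lie superalgebras of `pgl` into `Vect`
    (SuperContact.IsLieSuperHom (SuperContact.projEmb l n) ∧
      Function.Injective (SuperContact.projEmb l n) ∧
      SuperContact.projVect l n ≤ SuperContact.vect l n) ∧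
    -- `A ↦ [A]` is injective on `spo`
    Function.Injective (SuperContact.spoToPgl l n) ∧
    -- the composite is an isomorphism of Lie superalgebras from `spo` onto `𝔤`
    (∃ e : SuperContact.spo l n ≃ₗ[ℝ] SuperContact.quadContact l n,
      SuperContact.IsLieSuperIso e ∧
      ∀ A : SuperContact.spo l n,
        (e A : Module.End ℝ (SuperContact.SFun l n)) =
          SuperContact.projEmb l n (SuperContact.spoToPgl l n A)) ∧
    -- `𝔤` consists of contact vector fields, and the image of `spo` of contact projective ones
    SuperContact.quadContact l n ≤ SuperContact.contactVect l n ∧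
    LinearMap.range (SuperContact.projEmb l n ∘ₗ SuperContact.spoToPgl l n) ≤
      SuperContact.projVect l n ⊓ SuperContact.contactVect l n := by
  refine ⟨⟨SuperContact.projEmb_isLieSuperHom, SuperContact.projEmb_injective,
    SuperContact.projVect_le_vect⟩, SuperContact.spoToPgl_injective,
    ⟨SuperContact.spoEquiv l n, SuperContact.spoEquiv_isLieSuperIso, fun A => rfl⟩,
    SuperContact.quadContact_le_contactVect, le_inf ?_ ?_⟩
  · exact LinearMap.range_comp_le_range _ _
  · rw [SuperContact.range_projEmb_comp_spoToPgl]
    exact SuperContact.quadContact_le_contactVect
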